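/- Let $F=\mathrm{GF}(q)$ with $q=2^{2h+1}$, where $h$ is a natural number such that $2h+1$ is a prime different from $7$, and let $\mathrm{Tr}:F\to\mathrm{GF}(2)$ be the absolute trace. A maximal arc of degree $d$ in $\mathrm{PG}(2,q)$ is a non-empty proper subset of the points that meets every line in $0$ or $d$ points. Two point sets are isomorphic if some collineation of $\mathrm{PG}(2,q)$ (an element of $\mathrm{P\Gamma L}(3,q)$) maps one onto the other. For $\alpha,\beta,\lambda\in F$ with $\lambda\neq0$ and $\mathrm{Tr}(\alpha\beta)=1$, let $F_{\alpha,\beta,\lambda}$ be the conic $\alpha x^2+xy+\beta y^2+\lambda z^2=0$; all these conics have nucleus $(0,0,1)$. For $\lambda\ne\lambda'$ put $$F_{\alpha,\beta,\lambda}\oplus F_{\alpha',\beta',\lambda'}=F_{\alpha'',\beta'',\lambda+\lambda'},\qquad \alpha''=\frac{\alpha\lambda+\alpha'\lambda'}{\lambda+\lambda'},\quad \beta''=\frac{\beta\lambda+\beta'\lambda'}{\lambda+\lambda'}.$$ A set $\mathcal C$ of such conics is closed if for any two different members of $\mathcal C$ their composition $\oplus$ is defined and belongs to $\mathcal C$.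 A maximal arc is of Mathon type if it is isomorphic to the union of the conics of some closed set together with the point $(0,0,1)$. It is of Denniston type if it is isomorphic to the union of the conics $F_{\alpha,1,\lambda}$, $\lambda\in A$, together with $(0,0,1)$, for some $\alpha\in F$ with $\mathrm{Tr}(\alpha)=1$ and some $A\subseteq F\setminus\{0\}$ such that $A\cup\{0\}$ is closed under addition. A proper Mathon arc is a maximal arc of Mathon type that is not of Denniston type. Then the number of isomorphism classes of proper Mathon arcs of degree $8$ in $\mathrm{PG}(2,2^{2h+1})$ is exactly $$\frac{N}{14}\,(2^{2h-2}-1)\,\bigl((6h+3)N-1\bigr),\qquad\text{where } N=\frac{2^{2h}-1}{3(2h+1)}.$$ -/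

import Mathlib

open scoped LinearAlgebra.Projectivization

/-- The Desarguesian projective plane `PG(2,F)`: its points are the nonzero vectors of `F³` up to
scalars. -/
abbrev PG2 (F : Type*) [Field F] : Type _ := ℙ F (Fin 3 → F)

namespace PG2

section Plane

variable {F : Type*} [Field F]

/-- The point set of the line `[u,v,w]`: all points `(a,b,c)` with `a u + b v + c w = 0`. -/
def line (L : ℙ F (Fin 3 → F)) : Set (PG2 F) := {P | Projectivization.orthogonal P L}

/-- A maximal arc of degree `d`: a non-empty proper subset of the points such that every line meets
it in `0` or `d` points. -/
def IsMaximalArc (d : ℕ) (K : Set (PG2 F)) : Prop :=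
  K.Nonempty ∧ K ≠ Set.univ ∧
    ∀ L : ℙ F (Fin 3 → F), (K ∩ line L).ncard = 0 ∨ (K ∩ line L).ncard = d

/-- The elements of `PΓL(3,F)`, i.e. the collineations of `PG(2,F)`: the maps on points induced by
the bijective semilinear maps of `F³`, for arbitrary field automorphisms `σ`. -/
def IsCollineation (φ : PG2 F → PG2 F) : Prop :=
  ∃ (σ : F ≃+* F) (T : (Fin 3 → F) →ₛₗ[(σ : F →+* F)] (Fin 3 → F)) (hT : Function.Bijective T),
    φ = Projectivization.map T hT.injective

/-- Two point sets are isomorphic if some collineation maps one onto the other. -/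
def Isomorphic (K K' : Set (PG2 F)) : Prop :=
  ∃ φ : PG2 F → PG2 F, IsCollineation φ ∧ φ '' K = K'

theorem IsCollineation.id : IsCollineation (id : PG2 F → PG2 F) :=
  ⟨RingEquiv.refl F, LinearMap.id, Function.bijective_id, Projectivization.map_id.symm⟩

theorem IsCollineation.comp {φ ψ : PG2 F → PG2 F} (hφ : IsCollineation φ)
    (hψ : IsCollineation ψ) : IsCollineation (φ ∘ ψ) := by
  obtain ⟨σ, T, hT, rfl⟩ := hφ
  obtain ⟨τ, S, hS, rfl⟩ := hψ
  have : RingHomCompTriple (τ : F →+* F) (σ : F →+* F) ((τ.trans σ : F ≃+* F) : F →+* F) :=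
    ⟨rfl⟩
  exact ⟨τ.trans σ, T.comp S, hT.comp hS, (Projectivization.map_comp S hS.injective T
    hT.injective (hT.comp hS).injective).symm ▸ rfl⟩

theorem IsCollineation.exists_inverse {φ : PG2 F → PG2 F} (hφ : IsCollineation φ) :
    ∃ ψ : PG2 F → PG2 F, IsCollineation ψ ∧ ψ ∘ φ = _root_.id := by
  obtain ⟨σ, T, hT, rfl⟩ := hφ
  have := RingHomInvPair.of_ringEquiv σ
  have := RingHomInvPair.of_ringEquiv_symm σ
  let e := LinearEquiv.ofBijective T hT
  refine ⟨_, ⟨σ.symm, (e.symm : (Fin 3 → F) →ₛₗ[(σ.symm : F →+* F)] (Fin 3 → F)),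
    e.symm.bijective, rfl⟩, ?_⟩
  funext P
  induction P using Projectivization.ind with
  | h v hv =>
    simp only [Function.comp_apply, Projectivization.map_mk, _root_.id]
    congr 1
    exact e.symm_apply_apply v

theorem Isomorphic.refl (K : Set (PG2 F)) : Isomorphic K K := ⟨_, IsCollineation.id, by simp⟩

theorem Isomorphic.symm {K K' : Set (PG2 F)} (h : Isomorphic K K') : Isomorphic K' K := by
  obtain ⟨φ, hφ, rfl⟩ := h
  obtain ⟨ψ, hψ, hc⟩ := hφ.exists_inverse
  exact ⟨ψ, hψ, by rw [← Set.image_comp, hc, Set.image_id]⟩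

theorem Isomorphic.trans {K K' K'' : Set (PG2 F)} (h : Isomorphic K K') (h' : Isomorphic K' K'') :
    Isomorphic K K'' := by
  obtain ⟨φ, hφ, rfl⟩ := h
  obtain ⟨ψ, hψ, rfl⟩ := h'
  exact ⟨ψ ∘ φ, hψ.comp hφ, Set.image_comp ψ φ K⟩

/-- The conic `α x² + x y + β y² + l z² = 0`. The equation is homogeneous, so that it does not
matter which representative of a point is used, see `mk_mem_conic`. -/
def conic (α β l : F) : Set (PG2 F) :=
  {P | α * P.rep 0 ^ 2 + P.rep 0 * P.rep 1 + β * P.rep 1 ^ 2 + l * P.rep 2 ^ 2 = 0}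

theorem mk_mem_conic (α β l : F) (v : Fin 3 → F) (hv : v ≠ 0) :
    Projectivization.mk F v hv ∈ conic α β l ↔
      α * v 0 ^ 2 + v 0 * v 1 + β * v 1 ^ 2 + l * v 2 ^ 2 = 0 := by
  obtain ⟨a, ha⟩ := Projectivization.exists_smul_eq_mk_rep F v hv
  have h : ∀ i, (Projectivization.mk F v hv).rep i = (a : F) * v i := fun i => by
    rw [← ha]; rfl
  have h2 : α * ((a : F) * v 0) ^ 2 + (a * v 0) * (a * v 1) + β * (a * v 1) ^ 2
      + l * (a * v 2) ^ 2 =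
      (a : F) ^ 2 * (α * v 0 ^ 2 + v 0 * v 1 + β * v 1 ^ 2 + l * v 2 ^ 2) := by ring
  simp only [conic, Set.mem_ofPred_eq, h, h2, mul_eq_zero, pow_eq_zero_iff, ne_eq,
    OfNat.ofNat_ne_zero, not_false_eq_true, Units.ne_zero, false_or]

/-- The point `(0,0,1)`, the common nucleus of the conics above (in characteristic `2`). -/
def nucleus (F : Type*) [Field F] : PG2 F :=
  Projectivization.mk F ![0, 0, 1] (fun h => one_ne_zero (congrFun h 2))

end Plane

section Mathon

variable {F : Type*} [Field F] [Algebra (ZMod 2) F]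

/-- A conic `F_{α,β,l}` (`l ≠ 0`) of Mathon's family, given by its parameters; the condition is
`Tr(αβ) = 1` for the absolute trace `Tr`. -/
@[ext]
structure MathonConic (F : Type*) [Field F] [Algebra (ZMod 2) F] where
  α : F
  β : F
  l : F
  l_ne_zero : l ≠ 0
  trace_eq_one : Algebra.trace (ZMod 2) F (α * β) = 1

/-- The set of points of a conic of Mathon's family. -/
def MathonConic.points (C : MathonConic F) : Set (PG2 F) := conic C.α C.β C.l

/-- `IsComposition C C' D` says that `D = C ⊕ C'`, Mathon's composition of two conics with
different parameters `l`. -/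
def IsComposition (C C' D : MathonConic F) : Prop :=
  C.l ≠ C'.l ∧
    D.α = (C.α * C.l + C'.α * C'.l) / (C.l + C'.l) ∧
    D.β = (C.β * C.l + C'.β * C'.l) / (C.l + C'.l) ∧
    D.l = C.l + C'.l

/-- A set of conics of Mathon's family is closed if it contains the composition of any two of its
different members (in particular, this composition is defined and lies in the family). -/
def IsClosedSet (𝒞 : Set (MathonConic F)) : Prop :=
  ∀ C ∈ 𝒞, ∀ C' ∈ 𝒞, C ≠ C' → ∃ D ∈ 𝒞, IsComposition C C' D

/-- The points on a set of conics together with the common nucleus. -/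
def arcPoints (𝒞 : Set (MathonConic F)) : Set (PG2 F) :=
  insert (nucleus F) (⋃ C ∈ 𝒞, C.points)

/-- Arcs of Mathon type: in suitable coordinates, the points on a closed set of conics together
with the nucleus. -/
def IsMathonType (K : Set (PG2 F)) : Prop :=
  ∃ 𝒞 : Set (MathonConic F), IsClosedSet 𝒞 ∧ Isomorphic (arcPoints 𝒞) K

/-- Arcs of Denniston type: in suitable coordinates, the points on the conics `F_{α,1,l}`, `l ∈ A`,
of the standard pencil together with the nucleus, where `Tr(α) = 1`, `A` is a set of nonzero
elements and `A ∪ {0}` is closed under addition. -/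
def IsDennistonType (K : Set (PG2 F)) : Prop :=
  ∃ (α : F) (A : Set F), Algebra.trace (ZMod 2) F α = 1 ∧ 0 ∉ A ∧
    (∀ a ∈ insert 0 A, ∀ b ∈ insert 0 A, a + b ∈ insert 0 A) ∧
    Isomorphic (insert (nucleus F) (⋃ l ∈ A, conic α 1 l)) K

/-- Proper Mathon arcs of degree `d`: maximal arcs of degree `d` of Mathon type that are not of
Denniston type. -/
def IsProperMathonArc (d : ℕ) (K : Set (PG2 F)) : Prop :=
  IsMaximalArc d K ∧ IsMathonType K ∧ ¬ IsDennistonType K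

/-- Isomorphism of proper Mathon arcs of degree `d`, as an equivalence relation. -/
def properMathonSetoid (F : Type*) [Field F] [Algebra (ZMod 2) F] (d : ℕ) :
    Setoid {K : Set (PG2 F) // IsProperMathonArc d K} where
  r K K' := Isomorphic K.1 K'.1
  iseqv := ⟨fun K => Isomorphic.refl K.1, fun h => h.symm, fun h h' => h.trans h'⟩

/-- The number of isomorphism classes of proper Mathon arcs of degree `d` in `PG(2,F)`. -/
noncomputable def numProperMathonArcs (F : Type*) [Field F] [Algebra (ZMod 2) F] (d : ℕ) : ℕ :=
  Nat.card (Quotient (properMathonSetoid F d))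

end Mathon

end PG2

/-!
In characteristic two the closed sets of seven conics correspond to the groups `A` of order eight in
`F`, together with two functions `α, β` on `A \ {0}` for which `l α(l)` and `l β(l)` are additive
and `Tr (α(l) β(l)) = 1`.
Additive functions on `A` are polynomials `c₀ l + c₁ l² + c₂ l⁴` (`exists_additive_polynomial`), so
`α` and `β` are of the form `c₀ + c₁ l + c₂ l³` (`exists_cubicFamily`).

*Normal form.* A suitable change of coordinates makes `α = 1`
(`exists_cubicFamily_one`). If then `β` has no term `l³`, the arc is of Denniston type; otherwise a
scaling of `l`, which uses that cubing is bijective in a field of odd degree, and a shear give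
`β = l³ + m l + 1` with `Tr (l³ + m l) = 0` on `A`. Such an `m` exists if and only if `Tr (l³)` is
additive on `A`, that is, if `A` is totally isotropic for the alternating form
`Tr (x² y + x y²)`. Conversely all these arcs are proper Mathon arcs
(`IsNormalPair.isProperMathonArc`).

*Isomorphism.* For `q ≥ 32` a collineation between two arcs maps conics to conics: the image of a
conic has more than `4 · 7 + 1` points, while different conics share at most four
(`exists_conic_of_image`). Comparing equations, a substitution between two arcs in normal form must
have `c = e = 0`, `a = d`, and cannot scale `l`: the relevant expressions are cubic polynomials in
`l` with seven zeros. Hence two arcs in normal form are isomorphic if and only if their groups `A`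
are conjugate under the automorphisms of `F`; the parameter `m` does not matter
(`exists_map_eq_of_isomorphic_normal`, `isomorphic_normal_map`).

*Counting.* The form `Tr (x² y + x y²)` has radical `{0, 1}`, and counting ordered bases gives
`(q - 2) (q / 2 - 4) (q / 4 - 1) / 168` totally isotropic groups of order eight
(`ncard_isotropicTriples`, `card_isotropicOctet_mul`). The automorphism group of `F` has prime order
`p = 2 h + 1`, and acts freely on them when `p` is neither `3` nor `7` (`eq_one_of_map_eq`), so the
number of classes is the number of these groups divided by `p`. For `p = 3` there are no such
groups.
-/

open scoped LinearAlgebra.Projectivization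

namespace PG2

/-! ### The trace of a finite field of characteristic two -/

section FieldTwo

variable {F : Type*} [Field F] [Algebra (ZMod 2) F]

/-- The absolute trace of a field of characteristic two. -/
local notation "Tr" => Algebra.trace (ZMod 2) _

variable (F) in
theorem charP_two : CharP F 2 :=
  charP_of_injective_algebraMap (algebraMap (ZMod 2) F).injective 2

variable (F) in
theorem two_eq_zero : (2 : F) = 0 := by
  have := charP_two F
  exact CharTwo.two_eq_zero

theorem zmod_two_eq_one_of_ne_zero {x : ZMod 2} (h : x ≠ 0) : x = 1 := by
  revert x; decide

theorem add_self_zero (x : F) : x + x = 0 := by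
  have h2 := two_eq_zero F
  grind

theorem add_eq_zero_iff_eq_two {x y : F} : x + y = 0 ↔ x = y := by
  have h2 := two_eq_zero F
  grind

/-- Every automorphism of `F` is linear over the prime field. -/
def toPrimeAlgEquiv (σ : F ≃+* F) : F ≃ₐ[ZMod 2] F :=
  AlgEquiv.ofRingEquiv (f := σ) fun r => congrArg (fun f : ZMod 2 →+* F => f r)
    (RingHom.ext_zmod ((σ : F →+* F).comp (algebraMap (ZMod 2) F)) (algebraMap (ZMod 2) F))

theorem trace_ringEquiv (σ : F ≃+* F) (x : F) : Tr (σ x) = Tr x :=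
  Algebra.trace_eq_of_algEquiv (toPrimeAlgEquiv σ) x

variable (F) in
/-- The Artin–Schreier map `b ↦ b² + b`, whose image is the kernel of the trace. -/
noncomputable def artinSchreier : F →ₗ[ZMod 2] F :=
  (AddMonoidHom.mk' (fun b : F => b ^ 2 + b) (fun a b => by
    have h2 := two_eq_zero F
    grind)).toZModLinearMap 2

theorem artinSchreier_apply (b : F) : artinSchreier F b = b ^ 2 + b := rfl

theorem pow_natCard_eq {F : Type*} [Field F] [Finite F] (x : F) : x ^ Nat.card F = x := by
  have := Fintype.ofFinite F
  rw [Nat.card_eq_fintype_card, FiniteField.pow_card]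

section Finite

variable [Finite F]

theorem exists_sq_eq (x : F) : ∃ y, y ^ 2 = x := by
  have := charP_two F
  obtain ⟨y, hy⟩ := (isSquare_iff_exists_sq x).1
    (FiniteField.isSquare_of_char_two (ringChar.eq_iff.2 this) x)
  exact ⟨y, hy.symm⟩

theorem trace_sq (x : F) : Tr (x ^ 2) = Tr x := by
  have := charP_two F
  have : ExpChar F 2 := ExpChar.prime Nat.prime_two
  exact trace_ringEquiv (frobeniusEquiv F 2) x

theorem trace_surjective : Function.Surjective (Algebra.trace (ZMod 2) F) :=
  Algebra.trace_surjective (ZMod 2) F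

theorem trace_eq_zero_iff {c : F} : Tr c = 0 ↔ ∃ b, b ^ 2 + b = c := by
  have h2 := two_eq_zero F
  have hle : LinearMap.range (artinSchreier F) ≤ LinearMap.ker (Algebra.trace (ZMod 2) F) := by
    rintro _ ⟨b, rfl⟩
    rw [LinearMap.mem_ker, artinSchreier_apply, map_add, trace_sq]
    exact CharTwo.add_self_eq_zero _
  have hker : Module.finrank (ZMod 2) (LinearMap.ker (artinSchreier F)) ≤ 1 := by
    refine finrank_le_one ⟨1, by rw [LinearMap.mem_ker, artinSchreier_apply]; grind⟩ ?_
    rintro ⟨b, hb⟩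
    rw [LinearMap.mem_ker, artinSchreier_apply] at hb
    have : b = 0 ∨ b = 1 := by grind
    rcases this with rfl | rfl
    · exact ⟨0, Subtype.ext (by simp)⟩
    · exact ⟨1, by simp⟩
  have h1 := LinearMap.finrank_range_add_finrank_ker (artinSchreier F)
  have h3 := LinearMap.finrank_range_add_finrank_ker (Algebra.trace (ZMod 2) F)
  have h4 : Module.finrank (ZMod 2) (LinearMap.range (Algebra.trace (ZMod 2) F)) = 1 := by
    rw [LinearMap.range_eq_top.2 trace_surjective, finrank_top, Module.finrank_self]
  have heq := Submodule.eq_of_le_of_finrank_le hle (by omega)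
  rw [← LinearMap.mem_ker, ← heq, LinearMap.mem_range]
  rfl

theorem trace_one (hodd : Odd (Module.finrank (ZMod 2) F)) : Tr (1 : F) = 1 := by
  have := Algebra.trace_algebraMap (R := ZMod 2) (S := F) 1
  rw [map_one] at this
  rw [this, nsmul_one]
  exact (ZMod.natCast_eq_one_iff_odd).2 hodd

/-- Every additive function from a subspace to `GF(2)` is given by the trace form. -/
theorem exists_trace_mul_eq (A : Submodule (ZMod 2) F) (f : F → ZMod 2)
    (hf : ∀ x ∈ A, ∀ y ∈ A, f (x + y) = f x + f y) : ∃ m : F, ∀ x ∈ A, Tr (m * x) = f x := by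
  let g : A →ₗ[ZMod 2] ZMod 2 :=
    (AddMonoidHom.mk' (fun x : A => f x) (fun x y => hf x x.2 y y.2)).toZModLinearMap 2
  obtain ⟨G, hG⟩ := LinearMap.exists_extend g
  have hnd : (Algebra.traceForm (ZMod 2) F).Nondegenerate := traceForm_nondegenerate (ZMod 2) F
  refine ⟨((Algebra.traceForm (ZMod 2) F).toDual hnd).symm G, fun x hx => ?_⟩
  have h1 := LinearMap.BilinForm.apply_toDual_symm_apply (hB := hnd) G x
  rw [Algebra.traceForm_apply] at h1
  rw [h1]
  exact congrArg (fun k : A →ₗ[ZMod 2] ZMod 2 => k ⟨x, hx⟩) hG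

theorem card_eq_two_pow : Nat.card F = 2 ^ Module.finrank (ZMod 2) F := by
  rw [Module.natCard_eq_pow_finrank (K := ZMod 2), Nat.card_zmod]

/-- In a field with `2 ^ (2 k + 1)` elements, every element is a cube. -/
theorem exists_cube_eq (hodd : Odd (Module.finrank (ZMod 2) F)) (x : F) : ∃ y, y ^ 3 = x := by
  obtain ⟨k, hk⟩ := hodd
  have hq := card_eq_two_pow (F := F)
  rw [hk] at hq
  obtain ⟨e, he⟩ : ∃ e, 3 * e + 1 = 4 ^ (k + 1) := by
    have : 4 ^ (k + 1) % 3 = 1 := by simp [Nat.pow_mod]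
    exact ⟨4 ^ (k + 1) / 3, by omega⟩
  have h2q : 2 * Nat.card F = 3 * e + 1 := by
    rw [he, hq, show (4 : ℕ) = 2 ^ 2 by norm_num, ← pow_mul, ← pow_succ']
    congr 1
  rcases eq_or_ne x 0 with rfl | hx
  · exact ⟨0, by simp⟩
  · refine ⟨x ^ e, ?_⟩
    have h3 : x ^ (3 * e + 1) = x * x := by
      rw [← h2q, mul_comm, pow_mul, pow_natCard_eq, sq]
    rw [pow_succ] at h3
    rw [← pow_mul, mul_comm e]
    exact mul_right_cancel₀ hx h3

theorem eq_one_of_cube_eq_one (hodd : Odd (Module.finrank (ZMod 2) F)) {x : F} (hx : x ^ 3 = 1) :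
    x = 1 := by
  obtain ⟨k, hk⟩ := hodd
  have hq := card_eq_two_pow (F := F)
  rw [hk] at hq
  obtain ⟨e, he⟩ : ∃ e, 3 * e + 2 = Nat.card F := by
    have h1 : 4 ^ k % 3 = 1 := by simp [Nat.pow_mod]
    have : Nat.card F = 2 * 4 ^ k := by
      rw [hq, pow_succ', pow_mul]; norm_num
    exact ⟨Nat.card F / 3, by omega⟩
  have h := pow_natCard_eq x
  have h0 : x ≠ 0 := by rintro rfl; simp at hx
  rw [← he, pow_add, pow_mul, hx, one_pow, one_mul, sq] at h
  exact mul_right_cancel₀ h0 (h.trans (one_mul x).symm)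

end Finite

end FieldTwo

/-! ### Families of conics and the collineations between them -/

section Arc

variable {F : Type*} [Field F]

/-- The quadratic form `α x² + x y + β y² + l z²` whose zeros are the conic with parameters
`p = (α, β, l)`. -/
def conicForm (p : F × F × F) (v : Fin 3 → F) : F :=
  p.1 * v 0 ^ 2 + v 0 * v 1 + p.2.1 * v 1 ^ 2 + p.2.2 * v 2 ^ 2

/-- The points on the conics with parameters in `S`, together with the common nucleus. -/
def arc (S : Set (F × F × F)) : Set (PG2 F) :=
  insert (nucleus F) (⋃ p ∈ S, conic p.1 p.2.1 p.2.2)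

theorem mk_mem_conic_iff (p : F × F × F) (v : Fin 3 → F) (hv : v ≠ 0) :
    Projectivization.mk F v hv ∈ conic p.1 p.2.1 p.2.2 ↔ conicForm p v = 0 :=
  mk_mem_conic _ _ _ v hv

theorem mk_eq_nucleus_iff (v : Fin 3 → F) (hv : v ≠ 0) :
    Projectivization.mk F v hv = nucleus F ↔ v 0 = 0 ∧ v 1 = 0 := by
  rw [nucleus, Projectivization.mk_eq_mk_iff']
  constructor
  · rintro ⟨a, rfl⟩
    simp
  · rintro ⟨h0, h1⟩
    refine ⟨v 2, ?_⟩
    ext i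
    fin_cases i <;> simp [h0, h1]

theorem mk_mem_arc_iff (S : Set (F × F × F)) (v : Fin 3 → F) (hv : v ≠ 0) :
    Projectivization.mk F v hv ∈ arc S ↔ (v 0 = 0 ∧ v 1 = 0) ∨ ∃ p ∈ S, conicForm p v = 0 := by
  simp only [arc, Set.mem_insert_iff, mk_eq_nucleus_iff, Set.mem_iUnion, mk_mem_conic_iff,
    exists_prop]

/-- A semilinear substitution of `F³`, with field automorphism `σ`, that fixes the point
`(0,0,1)`:
`(x, y, z) ↦ (a σx + b σy, c σx + d σy, e σx + f σy + g σz)`. In characteristic two the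
determinant of its upper left block is `a d + b c`. -/
structure Substitution (F : Type*) [Field F] where
  /-- the field automorphism -/
  σ : F ≃+* F
  (a b c d e f g : F)
  det_ne_zero : a * d + b * c ≠ 0
  g_ne_zero : g ≠ 0

namespace Substitution

/-- The semilinear map of a substitution. -/
def toMap (T : Substitution F) : (Fin 3 → F) →ₛₗ[(T.σ : F →+* F)] (Fin 3 → F) where
  toFun v := ![T.a * T.σ (v 0) + T.b * T.σ (v 1), T.c * T.σ (v 0) + T.d * T.σ (v 1),
    T.e * T.σ (v 0) + T.f * T.σ (v 1) + T.g * T.σ (v 2)]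
  map_add' v w := by
    ext i
    fin_cases i <;> simp <;> ring
  map_smul' r v := by
    ext i
    fin_cases i <;> simp <;> ring

/-- `T.Rel p p'` says that `T` maps the conic `p` to the conic `p'`: pulling the quadratic form of
`p'` back along `T` gives `a d + b c` times the `σ`-conjugate of the form of `p`. -/
def Rel (T : Substitution F) (p p' : F × F × F) : Prop :=
  p'.1 * T.a ^ 2 + T.a * T.c + p'.2.1 * T.c ^ 2 + p'.2.2 * T.e ^ 2 =
      (T.a * T.d + T.b * T.c) * T.σ p.1 ∧
    p'.1 * T.b ^ 2 + T.b * T.d + p'.2.1 * T.d ^ 2 + p'.2.2 * T.f ^ 2 =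
      (T.a * T.d + T.b * T.c) * T.σ p.2.1 ∧
    p'.2.2 * T.g ^ 2 = (T.a * T.d + T.b * T.c) * T.σ p.2.2

theorem toMap_apply (T : Substitution F) (v : Fin 3 → F) :
    T.toMap v = ![T.a * T.σ (v 0) + T.b * T.σ (v 1), T.c * T.σ (v 0) + T.d * T.σ (v 1),
      T.e * T.σ (v 0) + T.f * T.σ (v 1) + T.g * T.σ (v 2)] := rfl

variable [Algebra (ZMod 2) F]

theorem toMap_injective (T : Substitution F) : Function.Injective T.toMap := by
  have h2 := two_eq_zero F
  rw [injective_iff_map_eq_zero]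
  intro v hv
  have hd := T.det_ne_zero
  have hg := T.g_ne_zero
  have e0 : T.a * T.σ (v 0) + T.b * T.σ (v 1) = 0 := congrFun hv 0
  have e1 : T.c * T.σ (v 0) + T.d * T.σ (v 1) = 0 := congrFun hv 1
  have e2 : T.e * T.σ (v 0) + T.f * T.σ (v 1) + T.g * T.σ (v 2) = 0 := congrFun hv 2
  have h0 : T.σ (v 0) = 0 := by grind
  have h1 : T.σ (v 1) = 0 := by grind
  have h2 : T.σ (v 2) = 0 := by grind
  rw [map_eq_zero_iff _ T.σ.injective] at h0 h1 h2
  ext i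
  fin_cases i <;> simpa

theorem Rel.conicForm_toMap {T : Substitution F} {p p' : F × F × F} (h : T.Rel p p')
    (v : Fin 3 → F) :
    conicForm p' (T.toMap v) = (T.a * T.d + T.b * T.c) * T.σ (conicForm p v) := by
  have h2 := two_eq_zero F
  obtain ⟨e1, e2, e3⟩ := h
  simp only [conicForm, toMap_apply, map_add, map_mul, map_pow, Matrix.cons_val_zero,
    Matrix.cons_val_one, Matrix.cons_val_two, Matrix.head_cons, Matrix.tail_cons]
  generalize T.σ (v 0) = x, T.σ (v 1) = y, T.σ (v 2) = z at *
  generalize T.σ p.1 = p0, T.σ p.2.1 = p1, T.σ p.2.2 = p2 at *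
  linear_combination x ^ 2 * e1 + y ^ 2 * e2 + z ^ 2 * e3 +
    (p'.1 * T.a * T.b * x * y + p'.2.1 * T.c * T.d * x * y +
      p'.2.2 * (T.e * T.f * x * y + T.e * T.g * x * z + T.f * T.g * y * z)) * h2

theorem Rel.conicForm_toMap_eq_zero {T : Substitution F} {p p' : F × F × F} (h : T.Rel p p')
    (v : Fin 3 → F) : conicForm p' (T.toMap v) = 0 ↔ conicForm p v = 0 := by
  rw [h.conicForm_toMap, mul_eq_zero, map_eq_zero_iff _ T.σ.injective]
  exact or_iff_right T.det_ne_zero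

theorem toMap_mem_nucleus (T : Substitution F) (v : Fin 3 → F) :
    (T.toMap v 0 = 0 ∧ T.toMap v 1 = 0) ↔ (v 0 = 0 ∧ v 1 = 0) := by
  have h2 := two_eq_zero F
  have hd := T.det_ne_zero
  simp only [toMap_apply, Matrix.cons_val_zero, Matrix.cons_val_one]
  constructor
  · rintro ⟨e0, e1⟩
    have h0 : T.σ (v 0) = 0 := by grind
    have h1 : T.σ (v 1) = 0 := by grind
    rw [map_eq_zero_iff _ T.σ.injective] at h0 h1
    exact ⟨h0, h1⟩
  · rintro ⟨e0, e1⟩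
    simp [e0, e1]

/-- A substitution that matches the conics of `S` with those of `S'` gives an isomorphism. -/
theorem isomorphic_arc [Finite F] (T : Substitution F) {S S' : Set (F × F × F)}
    (h : ∀ p ∈ S, ∃ p' ∈ S', T.Rel p p') (h' : ∀ p' ∈ S', ∃ p ∈ S, T.Rel p p') :
    Isomorphic (arc S) (arc S') := by
  have hbij : Function.Bijective T.toMap := Finite.injective_iff_bijective.1 T.toMap_injective
  have key : ∀ v, ((T.toMap v 0 = 0 ∧ T.toMap v 1 = 0) ∨ ∃ p ∈ S', conicForm p (T.toMap v) = 0) ↔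
      ((v 0 = 0 ∧ v 1 = 0) ∨ ∃ p ∈ S, conicForm p v = 0) := by
    intro v
    rw [T.toMap_mem_nucleus]
    refine or_congr_right ⟨?_, ?_⟩
    · rintro ⟨p', hp', h0⟩
      obtain ⟨p, hp, hr⟩ := h' p' hp'
      exact ⟨p, hp, (hr.conicForm_toMap_eq_zero v).1 h0⟩
    · rintro ⟨p, hp, h0⟩
      obtain ⟨p', hp', hr⟩ := h p hp
      exact ⟨p', hp', (hr.conicForm_toMap_eq_zero v).2 h0⟩
  refine ⟨_, ⟨T.σ, T.toMap, hbij, rfl⟩, ?_⟩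
  ext P
  constructor
  · rintro ⟨Q, hQ, rfl⟩
    induction Q using Projectivization.ind with
    | h v hv =>
      rw [Projectivization.map_mk, mk_mem_arc_iff, key]
      exact (mk_mem_arc_iff S v hv).1 hQ
  · intro hP
    induction P using Projectivization.ind with
    | h w hw =>
      obtain ⟨v, rfl⟩ := hbij.2 w
      have hv : v ≠ 0 := by rintro rfl; exact hw (map_zero _)
      refine ⟨Projectivization.mk F v hv, (mk_mem_arc_iff S v hv).2 ?_,
        Projectivization.map_mk _ _ _ _⟩
      rw [← key]
      exact (mk_mem_arc_iff S' _ hw).1 hP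

end Substitution

/-! ### Collineations between arcs with few conics -/

/-- A polynomial of degree at most four with five zeros has vanishing coefficients. -/
theorem quartic_coeff_eq_zero (Z : Finset F) (hZ : 5 ≤ Z.card) (n : Fin 5 → F)
    (h : ∀ s ∈ Z, n 4 * s ^ 4 + n 3 * s ^ 3 + n 2 * s ^ 2 + n 1 * s + n 0 = 0) (i : Fin 5) :
    n i = 0 := by
  let f : Polynomial F := ∑ i : Fin 5, Polynomial.monomial (i : ℕ) (n i)
  have hf : f = 0 := by
    refine Polynomial.eq_zero_of_natDegree_lt_card_of_eval_eq_zero' f Z (fun s hs => ?_) ?_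
    · rw [← h s hs]
      simp [f, Fin.sum_univ_five]
      ring
    · refine lt_of_lt_of_le ?_ hZ
      refine Nat.lt_succ_of_le (Polynomial.natDegree_sum_le_of_forall_le _ _ fun i _ => ?_)
      exact (Polynomial.natDegree_monomial_le _).trans (Nat.le_of_lt_succ i.2)
  have := congrArg (fun g => Polynomial.coeff g i) hf
  simpa [f, Polynomial.coeff_monomial, Fin.val_inj] using this

end Arc

section Image

variable {F : Type*} [Field F]

theorem semilinear_apply {σ : F ≃+* F} (T : (Fin 3 → F) →ₛₗ[(σ : F →+* F)] (Fin 3 → F))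
    (v : Fin 3 → F) (i : Fin 3) :
    T v i = σ (v 0) * T ![1, 0, 0] i + σ (v 1) * T ![0, 1, 0] i + σ (v 2) * T ![0, 0, 1] i := by
  have hv : v = v 0 • ![1, 0, 0] + v 1 • ![0, 1, 0] + v 2 • ![0, 0, 1] := by
    ext i
    fin_cases i <;> simp
  conv_lhs => rw [hv]
  simp only [map_add, map_smulₛₗ, Pi.add_apply, Pi.smul_apply, smul_eq_mul, RingHom.coe_coe]

variable [Algebra (ZMod 2) F] [Finite F]

/-- If a collineation maps the conic `p` into an arc with at most seven conics, then it fixes the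
nucleus and maps `p` to one of these conics. The points `(s², 1, √(α/l) s² + √(1/l) s + √(β/l))` of
`p` yield, for one of the conics, a polynomial of degree four with more than four zeros, and its
coefficients are the relations claimed. -/
theorem exists_conic_of_image (hq : 32 ≤ Nat.card F) {σ : F ≃+* F}
    (T : (Fin 3 → F) →ₛₗ[(σ : F →+* F)] (Fin 3 → F)) (hT : Function.Bijective T)
    {S' : Set (F × F × F)} (hS' : S'.ncard ≤ 7) {p : F × F × F} (hp : p.2.2 ≠ 0)
    (h : ∀ v, conicForm p v = 0 →
      (T v 0 = 0 ∧ T v 1 = 0) ∨ ∃ p' ∈ S', conicForm p' (T v) = 0) :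
    T ![0, 0, 1] 0 = 0 ∧ T ![0, 0, 1] 1 = 0 ∧ ∀ a b c d e f g : F,
      T ![1, 0, 0] = ![a, c, e] → T ![0, 1, 0] = ![b, d, f] → T ![0, 0, 1] 2 = g →
      ∃ p' ∈ S', p'.1 * a ^ 2 + a * c + p'.2.1 * c ^ 2 + p'.2.2 * e ^ 2 = (a * d + b * c) * σ p.1 ∧
        p'.1 * b ^ 2 + b * d + p'.2.1 * d ^ 2 + p'.2.2 * f ^ 2 = (a * d + b * c) * σ p.2.1 ∧
        p'.2.2 * g ^ 2 = (a * d + b * c) * σ p.2.2 := by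
  classical
  have := Fintype.ofFinite F
  have h2 := two_eq_zero F
  obtain ⟨α, β, l⟩ := p
  obtain ⟨x₂, hx⟩ := exists_sq_eq (α / l)
  obtain ⟨x₁, hx₁⟩ := exists_sq_eq (1 / l)
  obtain ⟨x₀, hx₀⟩ := exists_sq_eq (β / l)
  simp only at hp
  have hx1 : x₁ ≠ 0 := by
    rintro rfl
    simp only [ne_eq, OfNat.ofNat_ne_zero, not_false_eq_true, zero_pow, one_div] at hx₁
    exact inv_ne_zero hp hx₁.symm
  rw [eq_div_iff hp] at hx hx₁ hx₀
  let v : F → Fin 3 → F := fun s => ![s ^ 2, 1, x₂ * s ^ 2 + x₁ * s + x₀]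
  have hv : ∀ s, conicForm (α, β, l) (v s) = 0 := by
    intro s
    simp only [conicForm, v, Matrix.cons_val_zero, Matrix.cons_val_one, Matrix.cons_val]
    grind
  -- at most one of the points is mapped to the nucleus
  let Z₀ : Finset F := {s | T (v s) 0 = 0 ∧ T (v s) 1 = 0}
  have hZ₀ : Z₀.card ≤ 1 := by
    refine Finset.card_le_one.2 fun s hs t ht => ?_
    simp only [Z₀, Finset.mem_filter, Finset.mem_univ, true_and] at hs ht
    obtain ⟨u, hu⟩ := hT.2 ![0, 0, 1]
    have hm : ∀ s, T (v s) 0 = 0 → T (v s) 1 = 0 →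
        v s = (σ.symm (T (v s) 2)) • u := by
      intro s h0 h1
      apply hT.1
      rw [map_smulₛₗ, hu]
      ext i
      fin_cases i <;> simp [h0, h1]
    have e1 := hm s hs.1 hs.2
    have e2 := hm t ht.1 ht.2
    have a1 := congrFun e1 1
    have a2 := congrFun e2 1
    have b1 := congrFun e1 0
    have b2 := congrFun e2 0
    simp only [v, Pi.smul_apply, smul_eq_mul, Matrix.cons_val_zero,
      Matrix.cons_val_one] at a1 a2 b1 b2
    have hu1 : u 1 ≠ 0 := by
      intro h0
      rw [h0, mul_zero] at a1
      exact one_ne_zero a1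
    have : s ^ 2 = t ^ 2 := by grind
    grind
  -- by the pigeonhole principle, one of the conics contains the images of five of them
  have hfin : S'.Finite := Set.toFinite _
  have hc : ∀ s ∈ Finset.univ \ Z₀, ∃ p' ∈ S', conicForm p' (T (v s)) = 0 := by
    intro s hs
    have := h (v s) (hv s)
    simp only [Z₀, Finset.mem_sdiff, Finset.mem_univ, Finset.mem_filter, true_and] at hs
    exact this.resolve_left hs
  choose! P hP hP0 using hc
  have hcard : hfin.toFinset.card * 4 < (Finset.univ \ Z₀).card := by
    rw [← Set.ncard_eq_toFinset_card S' hfin, Finset.card_sdiff_of_subset (Finset.subset_univ _),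
      Finset.card_univ, ← Nat.card_eq_fintype_card]
    omega
  obtain ⟨p', hp', hmany⟩ := Finset.exists_lt_card_fiber_of_mul_lt_card_of_maps_to
    (f := P) (fun s hs => hfin.mem_toFinset.2 (hP s hs)) hcard
  rw [hfin.mem_toFinset] at hp'
  let Z := (({s ∈ Finset.univ \ Z₀ | P s = p'} : Finset F)).image σ
  have hZ : 5 ≤ Z.card := by
    rw [Finset.card_image_of_injective _ σ.injective]
    exact hmany
  set A := T ![1, 0, 0] with hA
  set B := T ![0, 1, 0] with hB
  set C := T ![0, 0, 1] with hC
  obtain ⟨α', β', l'⟩ := p'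
  set y₂ := σ x₂ with hy₂
  set y₁ := σ x₁ with hy₁
  set y₀ := σ x₀ with hy₀
  -- the pulled back form is `n₀₀ x² + n₁₁ y² + n₂₂ z² + n₀₁ x y + n₀₂ x z + n₁₂ y z`
  set n₀₀ := α' * A 0 ^ 2 + A 0 * A 1 + β' * A 1 ^ 2 + l' * A 2 ^ 2 with hn₀₀
  set n₁₁ := α' * B 0 ^ 2 + B 0 * B 1 + β' * B 1 ^ 2 + l' * B 2 ^ 2 with hn₁₁
  set n₂₂ := α' * C 0 ^ 2 + C 0 * C 1 + β' * C 1 ^ 2 + l' * C 2 ^ 2 with hn₂₂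
  set n₀₁ := A 0 * B 1 + B 0 * A 1 with hn₀₁
  set n₀₂ := A 0 * C 1 + C 0 * A 1 with hn₀₂
  set n₁₂ := B 0 * C 1 + C 0 * B 1 with hn₁₂
  have hzero := quartic_coeff_eq_zero Z hZ
    ![n₁₁ + n₂₂ * y₀ ^ 2 + n₁₂ * y₀, n₁₂ * y₁, n₀₁ + n₂₂ * y₁ ^ 2 + n₀₂ * y₀ + n₁₂ * y₂,
      n₀₂ * y₁, n₀₀ + n₂₂ * y₂ ^ 2 + n₀₂ * y₂] (by
    intro t ht
    obtain ⟨s, hs, rfl⟩ := Finset.mem_image.1 ht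
    obtain ⟨hs1, hs2⟩ := Finset.mem_filter.1 hs
    have := hP0 s hs1
    rw [hs2] at this
    simp only [conicForm, semilinear_apply T (v s), ← hA, ← hB, ← hC] at this
    simp only [v, Matrix.cons_val_zero, Matrix.cons_val_one, Matrix.cons_val, map_add, map_mul,
      map_pow, map_one, ← hy₂, ← hy₁, ← hy₀] at this ⊢
    generalize σ s = t at *
    rw [← this]
    simp only [hn₀₀, hn₁₁, hn₂₂, hn₀₁, hn₀₂, hn₁₂]
    clear * - h2
    grind)
  have hσ1 : y₁ ≠ 0 := by rwa [hy₁, Ne, map_eq_zero_iff _ σ.injective]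
  have z0 := hzero 0
  have z1 := hzero 1
  have z2 := hzero 2
  have z3 := hzero 3
  have z4 := hzero 4
  simp only [Matrix.cons_val_zero, Matrix.cons_val_one, Matrix.cons_val] at z0 z1 z2 z3 z4
  have m02 : n₀₂ = 0 := by simpa [hσ1] using z3
  have m12 : n₁₂ = 0 := by simpa [hσ1] using z1
  rw [m02, m12] at z2
  rw [m12] at z0
  rw [m02] at z4
  -- the functional `w ↦ w₀ C₁ + w₁ C₀` vanishes on the image of `T`
  have hfun : ∀ w : Fin 3 → F, w 0 * C 1 + w 1 * C 0 = 0 := by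
    intro w
    obtain ⟨u, rfl⟩ := hT.2 w
    rw [semilinear_apply T u 0, semilinear_apply T u 1, ← hA, ← hB, ← hC]
    clear * - h2 m02 m12 hn₀₂ hn₁₂
    grind
  have hC1 : C 1 = 0 := by simpa using hfun ![1, 0, 0]
  have hC0 : C 0 = 0 := by simpa using hfun ![0, 1, 0]
  refine ⟨hC0, hC1, fun a b c d e f g ha hb hg => ⟨_, hp', ?_⟩⟩
  rw [hC0, hC1, hg] at hn₂₂
  simp only [ha, hb, Matrix.cons_val_zero, Matrix.cons_val_one, Matrix.cons_val]
    at hn₀₀ hn₁₁ hn₀₁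
  have s2 : σ α = y₂ ^ 2 * σ l := by rw [← hx, map_mul, map_pow]
  have s1 : 1 = y₁ ^ 2 * σ l := by rw [← map_one σ, ← hx₁, map_mul, map_pow]
  have s0 : σ β = y₀ ^ 2 * σ l := by rw [← hx₀, map_mul, map_pow]
  simp only
  generalize σ l = L at *
  have hn : n₂₂ = n₀₁ * L := by
    clear * - h2 z2 s1
    grind
  refine ⟨?_, ?_, ?_⟩
  · rw [← hn₀₀, ← hn₀₁, s2]
    clear * - h2 z4 hn
    grind
  · rw [← hn₁₁, ← hn₀₁, s0]
    clear * - h2 z0 hn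
    grind
  · rw [← hn₀₁]
    clear * - hn hn₂₂
    grind

/-- A collineation from one arc onto another, with at most seven conics, comes from a substitution.
It maps each conic of the first arc to one of the second, and each point of the second arc other than
the nucleus lies on a conic obtained in this way. -/
theorem exists_substitution_of_image (hq : 32 ≤ Nat.card F) {S S' : Set (F × F × F)}
    (hS : ∀ p ∈ S, p.2.2 ≠ 0) (hne : S.Nonempty) (hS' : S'.ncard ≤ 7)
    (h : Isomorphic (arc S) (arc S')) :
    ∃ T : Substitution F, (∀ p ∈ S, ∃ p' ∈ S', T.Rel p p') ∧
      ∀ v : Fin 3 → F, (¬(v 0 = 0 ∧ v 1 = 0)) → (∃ p' ∈ S', conicForm p' v = 0) →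
        ∃ p ∈ S, ∃ p' ∈ S', T.Rel p p' ∧ conicForm p' v = 0 := by
  have h2 := two_eq_zero F
  obtain ⟨_, ⟨σ, T, hT, rfl⟩, himage⟩ := h
  have hmem : ∀ p ∈ S, ∀ v, conicForm p v = 0 →
      (T v 0 = 0 ∧ T v 1 = 0) ∨ ∃ p' ∈ S', conicForm p' (T v) = 0 := by
    intro p hp v hv
    rcases eq_or_ne v 0 with rfl | hv0
    · left
      rw [map_zero]
      exact ⟨rfl, rfl⟩
    · have hTv : T v ≠ 0 := fun h0 => hv0 (hT.1 (h0.trans (map_zero T).symm))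
      rw [← mk_mem_arc_iff S' _ hTv, ← himage]
      exact ⟨Projectivization.mk F v hv0, (mk_mem_arc_iff S v hv0).2 (Or.inr ⟨p, hp, hv⟩),
        Projectivization.map_mk _ _ _ _⟩
  obtain ⟨p₀, hp₀⟩ := hne
  obtain ⟨hC0, hC1, -⟩ := exists_conic_of_image hq T hT hS' (hS p₀ hp₀) (hmem p₀ hp₀)
  set A := T ![1, 0, 0] with hA
  set B := T ![0, 1, 0] with hB
  set C := T ![0, 0, 1] with hC
  have hdet : A 0 * B 1 + B 0 * A 1 ≠ 0 := by
    intro hd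
    have hA0 : ∀ w : Fin 3 → F, w 0 * A 1 + w 1 * A 0 = 0 := by
      intro w
      obtain ⟨u, rfl⟩ := hT.2 w
      rw [semilinear_apply T u 0, semilinear_apply T u 1, ← hA, ← hB, ← hC, hC0, hC1]
      clear * - h2 hd
      grind
    have hA1 : A 1 = 0 := by simpa using hA0 ![1, 0, 0]
    have hA0 : A 0 = 0 := by simpa using hA0 ![0, 1, 0]
    obtain ⟨u, hu⟩ := hT.2 ![0, 1, 0]
    obtain ⟨u', hu'⟩ := hT.2 ![1, 0, 0]
    have e1 := congrFun hu 0
    have e2 := congrFun hu 1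
    have e3 := congrFun hu' 0
    have e4 := congrFun hu' 1
    rw [semilinear_apply] at e1 e2 e3 e4
    rw [← hA, ← hB, ← hC] at e1 e2 e3 e4
    simp only [hA0, hA1, hC0, hC1, Matrix.cons_val_zero, Matrix.cons_val_one] at e1 e2 e3 e4
    clear * - e1 e2 e3 e4
    grind
  have hg : C 2 ≠ 0 := by
    intro hg
    have : T ![0, 0, 1] = T 0 := by
      rw [map_zero]
      ext i
      fin_cases i <;> assumption
    have := congrFun (hT.1 this) 2
    simp at this
  let T' : Substitution F := ⟨σ, A 0, B 0, A 1, B 1, A 2, B 2, C 2, hdet, hg⟩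
  have hrel : ∀ p ∈ S, ∃ p' ∈ S', T'.Rel p p' := fun p hp =>
    (exists_conic_of_image hq T hT hS' (hS p hp) (hmem p hp)).2.2 _ _ _ _ _ _ _
      (by ext i; fin_cases i <;> rfl) (by ext i; fin_cases i <;> rfl) rfl
  have hTT : ∀ v, T v = T'.toMap v := by
    intro v
    ext i
    rw [semilinear_apply T v i, Substitution.toMap_apply, ← hA, ← hB, ← hC]
    fin_cases i <;> simp [T', hC0, hC1] <;> ring
  refine ⟨T', hrel, fun w hw hw' => ?_⟩
  obtain ⟨v, rfl⟩ := hT.2 w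
  have hTv : T v ≠ 0 := fun h0 => hw (by rw [h0]; exact ⟨rfl, rfl⟩)
  have hv : v ≠ 0 := by rintro rfl; exact hTv (map_zero T)
  have hin := (mk_mem_arc_iff S' _ hTv).2 (Or.inr hw')
  rw [← himage] at hin
  obtain ⟨Q, hQ, hQT⟩ := hin
  have := RingHomInvPair.of_ringEquiv σ
  have : Q = Projectivization.mk F v hv :=
    Projectivization.map_injective T hT.1 (hQT.trans (Projectivization.map_mk _ _ _ _).symm)
  rw [this, mk_mem_arc_iff] at hQ
  rw [hTT] at hw ⊢
  rcases hQ with hQ | ⟨p, hp, h0⟩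
  · exact absurd ((T'.toMap_mem_nucleus v).2 hQ) hw
  · obtain ⟨p', hp', hr⟩ := hrel p hp
    exact ⟨p, hp, p', hp', hr, (hr.conicForm_toMap_eq_zero v).2 h0⟩

end Image

/-! ### Arcs in normal form and their isomorphisms -/

section Normal

variable {F : Type*} [Field F] [Algebra (ZMod 2) F]

local notation "Tr" => Algebra.trace (ZMod 2) _

/-- The conics `x² + x y + (l³ + m l + 1) y² + l z² = 0`, for the nonzero elements `l` of an
additive subgroup `A`. -/
def normalFamily (A : Submodule (ZMod 2) F) (m : F) : Set (F × F × F) :=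
  (fun l => (1, l ^ 3 + m * l + 1, l)) '' {l | l ∈ A ∧ l ≠ 0}

/-- The parameters `(A, m)` for which the conics of `normalFamily A m` satisfy Mathon's trace
condition and number seven. -/
structure IsNormalPair (A : Submodule (ZMod 2) F) (m : F) : Prop where
  card : Nat.card A = 8
  trace_eq_zero : ∀ l ∈ A, Tr (l ^ 3 + m * l) = 0

theorem mem_normalFamily {A : Submodule (ZMod 2) F} {m : F} {p : F × F × F} :
    p ∈ normalFamily A m ↔ ∃ l, (l ∈ A ∧ l ≠ 0) ∧ (1, l ^ 3 + m * l + 1, l) = p := Iff.rfl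

theorem ncard_ne_zero_of_card {A : Submodule (ZMod 2) F} (hA : Nat.card A = 8) :
    {l | l ∈ A ∧ l ≠ 0}.ncard = 7 := by
  have h1 : {l | l ∈ A ∧ l ≠ 0} = (A : Set F) \ {0} := by
    ext l
    simp
  rw [h1, Set.ncard_sdiff_singleton_of_mem A.zero_mem]
  have : (A : Set F).ncard = 8 := hA
  omega

theorem exists_ne_zero_mem_of_card {A : Submodule (ZMod 2) F} (hA : Nat.card A = 8) :
    ∃ l ∈ A, l ≠ 0 := by
  have h := ncard_ne_zero_of_card hA
  obtain ⟨l, hl⟩ := Set.nonempty_of_ncard_ne_zero (by rw [h]; norm_num)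
  exact ⟨l, hl.1, hl.2⟩

variable [Finite F]

theorem ncard_normalFamily_le {A : Submodule (ZMod 2) F} (hA : Nat.card A = 8) (m : F) :
    (normalFamily A m).ncard ≤ 7 :=
  (Set.ncard_image_le (Set.toFinite _)).trans (ncard_ne_zero_of_card hA).le

/-- A cubic polynomial that vanishes on the seven nonzero elements of `A` is zero. -/
theorem cubic_coeff_eq_zero {A : Submodule (ZMod 2) F} (hA : Nat.card A = 8) {c₃ c₁ c₀ : F}
    (h : ∀ l ∈ A, l ≠ 0 → c₃ * l ^ 3 + c₁ * l + c₀ = 0) : c₃ = 0 ∧ c₁ = 0 ∧ c₀ = 0 := by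
  have hfin : {l | l ∈ A ∧ l ≠ 0}.Finite := Set.toFinite _
  have hz := quartic_coeff_eq_zero hfin.toFinset (by
    rw [← Set.ncard_eq_toFinset_card _ hfin, ncard_ne_zero_of_card hA]
    norm_num) ![c₀, c₁, 0, c₃, 0] (by
    intro s hs
    rw [hfin.mem_toFinset] at hs
    have := h s hs.1 hs.2
    simp only [Matrix.cons_val_zero, Matrix.cons_val_one, Matrix.cons_val]
    linear_combination this)
  exact ⟨hz 3, hz 1, hz 0⟩

/-- For an arc in normal form every conic is obtained, because the point of this conic on the line
`y = 0` lies on no other conic of the arc. -/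
theorem exists_substitution_normal (hq : 32 ≤ Nat.card F) {S : Set (F × F × F)}
    (hS : ∀ p ∈ S, p.2.2 ≠ 0) {A : Submodule (ZMod 2) F} (hA : Nat.card A = 8) {m : F}
    (h : Isomorphic (arc S) (arc (normalFamily A m))) :
    ∃ T : Substitution F, ∀ l ∈ A, l ≠ 0 → ∃ p ∈ S, T.Rel p (1, l ^ 3 + m * l + 1, l) := by
  have h2 := two_eq_zero F
  have hpt : ∀ l ∈ A, l ≠ 0 → ∃ v : Fin 3 → F, ¬(v 0 = 0 ∧ v 1 = 0) ∧
      conicForm (1, l ^ 3 + m * l + 1, l) v = 0 ∧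
      ∀ l', conicForm (1, l' ^ 3 + m * l' + 1, l') v = 0 → l' = l := by
    intro l hl hl0
    obtain ⟨z, hz⟩ := exists_sq_eq (1 / l)
    rw [eq_div_iff hl0] at hz
    refine ⟨![1, 0, z], by simp, ?_, fun l' hl' => ?_⟩ <;>
      simp only [conicForm, Matrix.cons_val_zero, Matrix.cons_val_one, Matrix.cons_val] at * <;>
      grind
  have hne : S.Nonempty := by
    by_contra hne
    rw [Set.not_nonempty_iff_eq_empty] at hne
    subst hne
    obtain ⟨l, hl, hl0⟩ := exists_ne_zero_mem_of_card hA
    obtain ⟨v, hv0, hv, -⟩ := hpt l hl hl0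
    have hvne : v ≠ 0 := fun h0 => hv0 (by rw [h0]; exact ⟨rfl, rfl⟩)
    obtain ⟨φ, -, hφ⟩ := h
    have he : arc (∅ : Set (F × F × F)) = {nucleus F} := by simp [arc]
    rw [he, Set.image_singleton] at hφ
    have h1 := (mk_mem_arc_iff (normalFamily A m) v hvne).2 (Or.inr ⟨_, ⟨l, ⟨hl, hl0⟩, rfl⟩, hv⟩)
    have h3 : nucleus F ∈ arc (normalFamily A m) := Set.mem_insert _ _
    rw [← hφ, Set.mem_singleton_iff] at h1 h3
    exact hv0 ((mk_eq_nucleus_iff v hvne).1 (h1.trans h3.symm))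
  obtain ⟨T, -, hT⟩ := exists_substitution_of_image hq hS hne (ncard_normalFamily_le hA m) h
  refine ⟨T, fun l hl hl0 => ?_⟩
  obtain ⟨v, hv0, hv, huniq⟩ := hpt l hl hl0
  obtain ⟨p, hp, p', hp', hr, hv'⟩ := hT v hv0 ⟨_, ⟨l, ⟨hl, hl0⟩, rfl⟩, hv⟩
  obtain ⟨l', -, rfl⟩ := mem_normalFamily.1 hp'
  rw [huniq l' hv'] at hr
  exact ⟨p, hp, hr⟩

/-- In the two relations for `x²` and `y²` the conics of a Denniston arc contribute a constant, so
that both are cubic polynomials in `l` with seven zeros; their leading coefficients give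
`c = d = 0`. -/
theorem not_isDennistonType_normal (hq : 32 ≤ Nat.card F) {A : Submodule (ZMod 2) F}
    (hA : Nat.card A = 8) (m : F) : ¬ IsDennistonType (arc (normalFamily A m)) := by
  have h2 := two_eq_zero F
  rintro ⟨α, B, -, h0, -, hiso⟩
  have hB : insert (nucleus F) (⋃ l ∈ B, conic α 1 l) = arc ((fun l => (α, 1, l)) '' B) := by
    simp [arc]
  rw [hB] at hiso
  obtain ⟨T, hT⟩ := exists_substitution_normal hq (by
    rintro _ ⟨l, hl, rfl⟩ (rfl : l = 0)
    exact h0 hl) hA hiso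
  have h1 := cubic_coeff_eq_zero hA (c₃ := T.c ^ 2) (c₁ := T.c ^ 2 * m + T.e ^ 2)
    (c₀ := T.a ^ 2 + T.a * T.c + T.c ^ 2 + (T.a * T.d + T.b * T.c) * T.σ α) (by
      intro l hl hl0
      obtain ⟨_, ⟨k, -, rfl⟩, e1, e2, e3⟩ := hT l hl hl0
      simp only at e1
      grind)
  have h3 := cubic_coeff_eq_zero hA (c₃ := T.d ^ 2) (c₁ := T.d ^ 2 * m + T.f ^ 2)
    (c₀ := T.b ^ 2 + T.b * T.d + T.d ^ 2 + (T.a * T.d + T.b * T.c)) (by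
      intro l hl hl0
      obtain ⟨_, ⟨k, -, rfl⟩, e1, e2, e3⟩ := hT l hl hl0
      simp only [map_one] at e2
      grind)
  have hc : T.c = 0 := pow_eq_zero_iff two_ne_zero |>.1 h1.1
  have hd : T.d = 0 := pow_eq_zero_iff two_ne_zero |>.1 h3.1
  exact T.det_ne_zero (by rw [hc, hd]; ring)

/-- A substitution between two arcs in normal form has `c = e = 0` and `a = d`, because a cubic
polynomial vanishes on `A'`; comparing the coefficients of `l³` in the second relation then shows
that it does not scale the parameter `l`. -/
theorem exists_map_eq_of_isomorphic_normal (hodd : Odd (Module.finrank (ZMod 2) F))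
    (hq : 32 ≤ Nat.card F) {A A' : Submodule (ZMod 2) F}
    (hA : Nat.card A = 8) (hA' : Nat.card A' = 8) {m m' : F}
    (h : Isomorphic (arc (normalFamily A m)) (arc (normalFamily A' m'))) :
    ∃ σ : F ≃ₐ[ZMod 2] F, A.map σ.toLinearMap = A' := by
  have h2 := two_eq_zero F
  obtain ⟨T, hT⟩ := exists_substitution_normal hq (by
    rintro _ ⟨l, hl, rfl⟩
    exact hl.2) hA' h
  have hdet := T.det_ne_zero
  have h1 := cubic_coeff_eq_zero hA' (c₃ := T.c ^ 2) (c₁ := T.c ^ 2 * m' + T.e ^ 2)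
    (c₀ := T.a ^ 2 + T.a * T.c + T.c ^ 2 + (T.a * T.d + T.b * T.c)) (by
      intro l hl hl0
      obtain ⟨_, ⟨k, -, rfl⟩, e1, e2, e3⟩ := hT l hl hl0
      simp only [map_one] at e1
      grind)
  have hc : T.c = 0 := pow_eq_zero_iff two_ne_zero |>.1 h1.1
  have ha : T.a ≠ 0 := by
    intro ha
    exact hdet (by rw [ha, hc]; ring)
  have hd : T.d = T.a := by
    have := h1.2.2
    rw [hc] at this
    have : T.a * (T.a + T.d) = 0 := by linear_combination this
    have := (mul_eq_zero.1 this).resolve_left ha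
    exact (add_eq_zero_iff_eq_two.1 this).symm
  obtain ⟨γ, hγ⟩ : ∃ γ, γ * T.a ^ 2 = T.g ^ 2 := ⟨T.g ^ 2 / T.a ^ 2, by field_simp⟩
  have hscale : ∀ l k, l * T.g ^ 2 = (T.a * T.d + T.b * T.c) * T.σ k → T.σ k = γ * l := by
    intro l k hlk
    rw [hc, hd, ← hγ] at hlk
    have : T.a ^ 2 * (T.σ k) = T.a ^ 2 * (γ * l) := by linear_combination -hlk
    exact mul_left_cancel₀ (pow_ne_zero 2 ha) this
  have h3 := cubic_coeff_eq_zero hA' (c₃ := T.a ^ 2 * (1 + γ ^ 3))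
    (c₁ := T.a ^ 2 * (m' + T.σ m * γ) + T.f ^ 2) (c₀ := T.b ^ 2 + T.b * T.a) (by
      intro l hl hl0
      obtain ⟨_, ⟨k, -, rfl⟩, e1, e2, e3⟩ := hT l hl hl0
      simp only [map_one, map_add, map_mul, map_pow] at e2 e3
      rw [hscale l k e3, hc, hd] at e2
      grind)
  have hγ1 : γ = 1 := by
    refine eq_one_of_cube_eq_one hodd ?_
    have := (mul_eq_zero.1 h3.1).resolve_left (pow_ne_zero 2 ha)
    exact (add_eq_zero_iff_eq_two.1 this).symm
  refine ⟨toPrimeAlgEquiv T.σ, ?_⟩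
  have hle : A' ≤ A.map (toPrimeAlgEquiv T.σ).toLinearMap := by
    intro l hl
    rcases eq_or_ne l 0 with rfl | hl0
    · exact Submodule.zero_mem _
    · obtain ⟨_, ⟨k, hk, rfl⟩, e1, e2, e3⟩ := hT l hl hl0
      exact ⟨k, hk.1, (hscale l k e3).trans (by rw [hγ1, one_mul])⟩
  have hcard : Nat.card (A.map (toPrimeAlgEquiv T.σ).toLinearMap) = 8 :=
    (Nat.card_congr (A.equivMapOfInjective _ (toPrimeAlgEquiv T.σ).injective).toEquiv).symm.trans hA
  have := Set.eq_of_subset_of_ncard_le (s := (A' : Set F)) hle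
    (le_of_eq (hcard.trans hA'.symm)) (Set.toFinite _)
  exact (SetLike.coe_injective this).symm

/-- Conversely, conjugate subgroups give isomorphic arcs: the parameter `m` can be adjusted by a
substitution `z ↦ z + f y`. -/
theorem isomorphic_normal_map (σ : F ≃ₐ[ZMod 2] F) (A : Submodule (ZMod 2) F) (m m' : F) :
    Isomorphic (arc (normalFamily A m)) (arc (normalFamily (A.map σ.toLinearMap) m')) := by
  have h2 := two_eq_zero F
  obtain ⟨f, hf⟩ := exists_sq_eq (m' + σ m)
  let T : Substitution F := ⟨σ.toRingEquiv, 1, 0, 0, 1, 0, f, 1, by simp, one_ne_zero⟩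
  have hrel : ∀ l, T.Rel (1, l ^ 3 + m * l + 1, l) (1, σ l ^ 3 + m' * σ l + 1, σ l) := by
    intro l
    have hσ : ∀ x, T.σ x = σ x := fun _ => rfl
    refine ⟨?_, ?_, ?_⟩ <;> simp only [hσ, map_one, map_add, map_mul, map_pow, T] <;> grind
  refine T.isomorphic_arc ?_ ?_
  · rintro _ ⟨l, ⟨hl, hl0⟩, rfl⟩
    exact ⟨_, ⟨σ l, ⟨⟨l, hl, rfl⟩, by simpa using hl0⟩, rfl⟩, hrel l⟩
  · rintro _ ⟨_, ⟨⟨l, hl, rfl⟩, hl0⟩, rfl⟩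
    exact ⟨_, ⟨l, ⟨hl, by rintro rfl; simp at hl0⟩, rfl⟩, hrel l⟩

end Normal

/-! ### Arcs in normal form are proper Mathon arcs of degree eight -/

section Maximal

variable {F : Type*} [Field F] [Algebra (ZMod 2) F]

local notation "Tr" => Algebra.trace (ZMod 2) _

theorem ncard_biUnion_of_pairwiseDisjoint {ι X : Type*} [Finite X] (s : Finset ι) (f : ι → Set X)
    (h : ∀ i ∈ s, ∀ j ∈ s, i ≠ j → Disjoint (f i) (f j)) :
    (⋃ i ∈ s, f i).ncard = ∑ i ∈ s, (f i).ncard := by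
  classical
  induction s using Finset.induction_on with
  | empty => simp
  | insert a s ha ih =>
    rw [Finset.set_biUnion_insert, Finset.sum_insert ha, Set.ncard_union_eq ?_ (Set.toFinite _)
      (Set.toFinite _), ih fun i hi j hj => h i (Finset.mem_insert_of_mem hi) j
        (Finset.mem_insert_of_mem hj)]
    rw [Set.disjoint_iUnion₂_right]
    intro i hi
    exact h a (Finset.mem_insert_self _ _) i (Finset.mem_insert_of_mem hi)
      (by rintro rfl; exact ha hi)

variable {A : Submodule (ZMod 2) F} {m : F}

/-- The trace form `Tr (x² y + x y²)` vanishes on the group of a normal pair. -/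
theorem IsNormalPair.isotropic (h : IsNormalPair A m) {x y : F} (hx : x ∈ A) (hy : y ∈ A) :
    Tr (x ^ 2 * y + x * y ^ 2) = 0 := by
  have h2 := two_eq_zero F
  have h1 := h.trace_eq_zero _ (A.add_mem hx hy)
  have e : (x + y) ^ 3 + m * (x + y) =
      (x ^ 3 + m * x) + (y ^ 3 + m * y) + (x ^ 2 * y + x * y ^ 2) := by grind
  rw [e, map_add, map_add, h.trace_eq_zero _ hx, h.trace_eq_zero _ hy, zero_add, zero_add] at h1
  exact h1

theorem mem_line_iff {F : Type*} [Field F] {v w : Fin 3 → F} (hv : v ≠ 0) (hw : w ≠ 0) :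
    Projectivization.mk F v hv ∈ line (Projectivization.mk F w hw) ↔
      v 0 * w 0 + v 1 * w 1 + v 2 * w 2 = 0 := by
  rw [line, Set.mem_ofPred_eq, Projectivization.orthogonal_mk]
  simp [dotProduct, Fin.sum_univ_three]

theorem vec_ne_zero_of_snd {F : Type*} [Field F] {x y z : F} (hy : y ≠ 0) :
    (![x, y, z] : Fin 3 → F) ≠ 0 :=
  fun h => hy (congrFun h 1)

theorem vec_ne_zero_of_fst {F : Type*} [Field F] {x y z : F} (hx : x ≠ 0) :
    (![x, y, z] : Fin 3 → F) ≠ 0 :=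
  fun h => hx (congrFun h 0)

variable [Finite F]

/-- An additive function from a group of order eight to `GF(2)` takes the value `1` never or four
times. -/
theorem ncard_eq_one_of_additive (hA : Nat.card A = 8)
    (f : F → ZMod 2) (hf : ∀ x ∈ A, ∀ y ∈ A, f (x + y) = f x + f y) :
    {l | l ∈ A ∧ f l = 1}.ncard = 0 ∨ {l | l ∈ A ∧ f l = 1}.ncard = 4 := by
  by_cases hex : ∃ k ∈ A, f k = 1
  · right
    obtain ⟨k, hk, hk1⟩ := hex
    have himg : (fun x => x + k) '' {l | l ∈ A ∧ f l = 1} = {l | l ∈ A ∧ f l = 0} := by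
      ext x
      constructor
      · rintro ⟨y, ⟨hy, hy1⟩, rfl⟩
        refine ⟨A.add_mem hy hk, ?_⟩
        rw [hf y hy k hk, hy1, hk1]
        rfl
      · rintro ⟨hx, hx0⟩
        refine ⟨x + k, ⟨A.add_mem hx hk, ?_⟩, ?_⟩
        · rw [hf x hx k hk, hx0, hk1]
          rfl
        · simp only [add_assoc, add_self_zero, add_zero]
    have hcard := Set.ncard_image_of_injective {l | l ∈ A ∧ f l = 1} (add_left_injective k)
    rw [himg] at hcard
    have hun : {l | l ∈ A ∧ f l = 1} ∪ {l | l ∈ A ∧ f l = 0} = (A : Set F) := by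
      ext x
      have : ∀ y : ZMod 2, y = 1 ∨ y = 0 := by decide
      simp only [Set.mem_union, Set.mem_ofPred_eq, ← and_or_left, SetLike.mem_coe, this, and_true]
    have h8 : (A : Set F).ncard = 8 := hA
    rw [← hun, Set.ncard_union_eq ?_ (Set.toFinite _) (Set.toFinite _), hcard] at h8
    · omega
    · rw [Set.disjoint_left]
      rintro x ⟨-, h1⟩ ⟨-, h0⟩
      rw [h0] at h1
      exact zero_ne_one h1
  · left
    rw [Set.ncard_eq_zero]
    ext x
    simp only [Set.mem_ofPred_eq, Set.mem_empty_iff_false, iff_false]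
    exact fun hx => hex ⟨x, hx⟩

/-- Different conics of a normal arc are disjoint. -/
theorem IsNormalPair.eq_of_conicForm_eq_zero (hodd : Odd (Module.finrank (ZMod 2) F))
    (h : IsNormalPair A m) {l l' : F} (hl : l ∈ A) (hl' : l' ∈ A) (hl0 : l ≠ 0)
    {v : Fin 3 → F} (hv : v ≠ 0) (h1 : conicForm (1, l ^ 3 + m * l + 1, l) v = 0)
    (h1' : conicForm (1, l' ^ 3 + m * l' + 1, l') v = 0) : l = l' := by
  have h2 := two_eq_zero F
  by_contra hne
  have hs : l + l' ≠ 0 := fun h0 => hne (add_eq_zero_iff_eq_two.1 h0)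
  simp only [conicForm] at h1 h1'
  -- eliminating `z` from the two equations
  have h3 : (l + l') * (v 0 ^ 2 + v 0 * v 1 + (l ^ 2 * l' + l * l' ^ 2 + 1) * v 1 ^ 2) = 0 := by
    grind
  have h4 := (mul_eq_zero.1 h3).resolve_left hs
  by_cases hy : v 1 = 0
  · have hx : v 0 = 0 := by
      rw [hy] at h4
      simpa using h4
    rw [hx, hy] at h1
    have hz : v 2 = 0 := by simpa [hl0] using h1
    apply hv
    ext i
    fin_cases i <;> assumption
  · have h5 : Tr (l ^ 2 * l' + l * l' ^ 2 + 1) = 0 := by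
      refine trace_eq_zero_iff.2 ⟨v 0 / v 1, ?_⟩
      field_simp
      grind
    rw [map_add, h.isotropic hl hl', trace_one hodd, zero_add] at h5
    exact one_ne_zero h5

/-- A line `z = u x + v y` meets the conic `(α, β, l)` in two points or none, according to the trace
of `(α + l u²) (β + l v²)`. -/
theorem ncard_conic_inter_line (α β l u v : F)
    (L : ℙ F (Fin 3 → F))
    (hL : ∀ w (hw : w ≠ 0), Projectivization.mk F w hw ∈ line L ↔ w 2 = u * w 0 + v * w 1) :
    (conic α β l ∩ line L).ncard =
      if Tr ((α + l * u ^ 2) * (β + l * v ^ 2)) = 0 then 2 else 0 := by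
  have h2 := two_eq_zero F
  set a := α + l * u ^ 2 with ha
  set c := β + l * v ^ 2 with hc
  have hmem : ∀ w (hw : w ≠ 0), Projectivization.mk F w hw ∈ conic α β l ∩ line L ↔
      w 2 = u * w 0 + v * w 1 ∧ a * w 0 ^ 2 + w 0 * w 1 + c * w 1 ^ 2 = 0 := by
    intro w hw
    rw [Set.mem_inter_iff, hL, mk_mem_conic, and_comm]
    refine and_congr_right fun hz => ?_
    rw [hz, ha, hc]
    constructor <;> intro h <;> grind
  split_ifs with htr
  · obtain ⟨t, ht⟩ := trace_eq_zero_iff.1 htr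
    by_cases ha0 : a = 0
    · -- the points `(c, 1)` and `(1, 0)`
      rw [Set.ncard_eq_two]
      have hne1 : (![c, 1, u * c + v] : Fin 3 → F) ≠ 0 := vec_ne_zero_of_snd one_ne_zero
      have hne2 : (![1, 0, u] : Fin 3 → F) ≠ 0 := vec_ne_zero_of_fst one_ne_zero
      refine ⟨Projectivization.mk F _ hne1, Projectivization.mk F _ hne2, ?_, ?_⟩
      · rw [Ne, Projectivization.mk_eq_mk_iff']
        rintro ⟨r, hr⟩
        have := congrFun hr 1
        simp at this
      · ext P
        induction P using Projectivization.ind with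
        | h w hw =>
          rw [hmem, ha0, Set.mem_insert_iff, Set.mem_singleton_iff,
            Projectivization.mk_eq_mk_iff', Projectivization.mk_eq_mk_iff']
          constructor
          · rintro ⟨hz, h0⟩
            by_cases hy : w 1 = 0
            · right
              refine ⟨w 0, ?_⟩
              ext i
              fin_cases i <;> simp [hy, hz, mul_comm]
            · left
              refine ⟨w 1, ?_⟩
              have : w 1 * (w 0 + c * w 1) = 0 := by linear_combination h0
              have := (mul_eq_zero.1 this).resolve_left hy
              have h0 : w 0 = c * w 1 := add_eq_zero_iff_eq_two.1 this
              ext i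
              fin_cases i <;> simp [hz, h0] <;> ring
          · rintro (⟨r, rfl⟩ | ⟨r, rfl⟩)
            · simp
              constructor <;> grind
            · simp [mul_comm]
    · -- the points `(t, a)` and `(t + 1, a)`, where `t² + t = a c`
      rw [Set.ncard_eq_two]
      have hne1 : ∀ x : F, (![x, a, u * x + v * a] : Fin 3 → F) ≠ 0 := fun x =>
        vec_ne_zero_of_snd ha0
      refine ⟨Projectivization.mk F _ (hne1 t), Projectivization.mk F _ (hne1 (t + 1)), ?_, ?_⟩
      · rw [Ne, Projectivization.mk_eq_mk_iff']
        rintro ⟨r, hr⟩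
        have e0 := congrFun hr 0
        have e1 := congrFun hr 1
        simp only [Pi.smul_apply, smul_eq_mul, Matrix.cons_val_zero, Matrix.cons_val_one] at e0 e1
        grind
      · ext P
        induction P using Projectivization.ind with
        | h w hw =>
          rw [hmem, Set.mem_insert_iff, Set.mem_singleton_iff,
            Projectivization.mk_eq_mk_iff', Projectivization.mk_eq_mk_iff']
          constructor
          · rintro ⟨hz, h0⟩
            have hprod : (a * w 0 + t * w 1) * (a * w 0 + (t + 1) * w 1) = 0 := by grind
            have key : ∀ x : F, a * w 0 + x * w 1 = 0 →
                ∃ r : F, r • ![x, a, u * x + v * a] = w := by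
              intro x hx
              have h0 : a * w 0 = x * w 1 := add_eq_zero_iff_eq_two.1 hx
              have h0' : w 0 = w 1 / a * x := by
                field_simp
                linear_combination h0
              have h1' : w 1 = w 1 / a * a := by field_simp
              refine ⟨w 1 / a, ?_⟩
              ext i
              fin_cases i
              · exact h0'.symm
              · exact h1'.symm
              · change w 1 / a * (u * x + v * a) = w 2
                rw [hz]
                linear_combination (-u) * h0' - v * h1'
            exact (mul_eq_zero.1 hprod).imp (key t) (key (t + 1))
          · rintro (⟨r, rfl⟩ | ⟨r, rfl⟩) <;>
              simp only [Pi.smul_apply, smul_eq_mul, Matrix.cons_val_zero, Matrix.cons_val_one,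
                Matrix.cons_val] <;> constructor <;> grind
  · rw [Set.ncard_eq_zero]
    ext P
    induction P using Projectivization.ind with
    | h w hw =>
      rw [hmem]
      simp only [Set.mem_empty_iff_false, iff_false]
      rintro ⟨hz, h0⟩
      by_cases hy : w 1 = 0
      · rw [hy] at h0
        have : a = 0 ∨ w 0 = 0 := by simpa using h0
        rcases this with ha0 | hx
        · exact htr (by rw [ha0, zero_mul, map_zero])
        · apply hw
          ext i
          fin_cases i <;> simp [hz, hx, hy]
      · refine htr (trace_eq_zero_iff.2 ⟨a * w 0 / w 1, ?_⟩)
        field_simp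
        grind

end Maximal

section NormalMaximal

variable {F : Type*} [Field F] [Algebra (ZMod 2) F] [Finite F]
  {A : Submodule (ZMod 2) F} {m : F}

local notation "Tr" => Algebra.trace (ZMod 2) _

/-- Since the conics of a normal arc are disjoint, the points of the arc on a line, apart from the
nucleus, can be counted conic by conic. -/
theorem IsNormalPair.ncard_inter_line (hodd : Odd (Module.finrank (ZMod 2) F))
    (h : IsNormalPair A m) (s : Finset F) (hs : ∀ l, l ∈ s ↔ l ∈ A ∧ l ≠ 0)
    (L : ℙ F (Fin 3 → F)) :
    ((arc (normalFamily A m) ∩ line L) \ {nucleus F}).ncard =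
      ∑ l ∈ s, (conic 1 (l ^ 3 + m * l + 1) l ∩ line L).ncard := by
  rw [← ncard_biUnion_of_pairwiseDisjoint]
  · congr 1
    ext P
    induction P using Projectivization.ind with
    | h v hv =>
      simp only [Set.mem_sdiff, Set.mem_inter_iff, mk_mem_arc_iff, Set.mem_singleton_iff,
        mk_eq_nucleus_iff, Set.mem_iUnion, mem_normalFamily, exists_prop]
      constructor
      · rintro ⟨⟨h1 | ⟨_, ⟨l, hl, rfl⟩, h1⟩, hL⟩, h3⟩
        · exact absurd h1 h3
        · exact ⟨l, (hs l).2 hl, (mk_mem_conic_iff (1, _, l) v hv).2 h1, hL⟩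
      · rintro ⟨l, hl, h1, hL⟩
        have h1 := (mk_mem_conic_iff (1, l ^ 3 + m * l + 1, l) v hv).1 h1
        refine ⟨⟨Or.inr ⟨_, ⟨l, (hs l).1 hl, rfl⟩, h1⟩, hL⟩, fun h0 => hv ?_⟩
        simp only [conicForm, h0.1, h0.2] at h1
        have hz : v 2 = 0 := by simpa [((hs l).1 hl).2] using h1
        ext i
        fin_cases i
        exacts [h0.1, h0.2, hz]
  · intro l hl l' hl' hne
    rw [Set.disjoint_left]
    intro P hP hP'
    induction P using Projectivization.ind with
    | h v hv =>
      exact hne (h.eq_of_conicForm_eq_zero hodd ((hs l).1 hl).1 ((hs l').1 hl').1 ((hs l).1 hl).2 hv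
        ((mk_mem_conic_iff (1, _, l) v hv).1 hP.1) ((mk_mem_conic_iff (1, _, l') v hv).1 hP'.1))

/-- A line through the nucleus meets a conic in one point. -/
theorem ncard_conic_inter_line_nucleus {α β l : F} (hl : l ≠ 0) {u v : F}
    (huv : ¬(u = 0 ∧ v = 0)) (L : ℙ F (Fin 3 → F))
    (hL : ∀ w (hw : w ≠ 0), Projectivization.mk F w hw ∈ line L ↔ u * w 0 + v * w 1 = 0) :
    (conic α β l ∩ line L).ncard = 1 := by
  have h2 := two_eq_zero F
  obtain ⟨z, hz⟩ := exists_sq_eq ((α * v ^ 2 + v * u + β * u ^ 2) / l)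
  rw [eq_div_iff hl] at hz
  have hne : (![v, u, z] : Fin 3 → F) ≠ 0 := fun h => huv ⟨congrFun h 1, congrFun h 0⟩
  rw [Set.ncard_eq_one]
  refine ⟨Projectivization.mk F _ hne, ?_⟩
  ext P
  induction P using Projectivization.ind with
  | h w hw =>
    rw [Set.mem_inter_iff, hL, mk_mem_conic, Set.mem_singleton_iff, Projectivization.mk_eq_mk_iff']
    constructor
    · rintro ⟨h1, h3⟩
      obtain ⟨r, hr0, hr1⟩ : ∃ r, w 0 = r * v ∧ w 1 = r * u := by
        by_cases hu : u = 0
        · have hv : v ≠ 0 := fun hv => huv ⟨hu, hv⟩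
          refine ⟨w 0 / v, by field_simp, ?_⟩
          rw [hu] at h3 ⊢
          simpa [hv] using h3
        · refine ⟨w 1 / u, ?_, by field_simp⟩
          field_simp
          grind
      refine ⟨r, ?_⟩
      have hz2 : l * (w 2 + r * z) ^ 2 = 0 := by grind
      have hz2 : w 2 + r * z = 0 := by simpa [hl] using hz2
      have hz2 := add_eq_zero_iff_eq_two.1 hz2
      ext i
      fin_cases i
      exacts [hr0.symm, hr1.symm, hz2.symm]
    · rintro ⟨r, rfl⟩
      simp only [Pi.smul_apply, smul_eq_mul, Matrix.cons_val_zero, Matrix.cons_val_one,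
        Matrix.cons_val]
      constructor <;> grind

/-- Arcs in normal form are maximal arcs: the line `z = u x + v y` meets the conic with parameter
`l` if and only if a function of `l` that is additive on `A` takes the value `1`. -/
theorem IsNormalPair.isMaximalArc (hodd : Odd (Module.finrank (ZMod 2) F))
    (h : IsNormalPair A m) : IsMaximalArc 8 (arc (normalFamily A m)) := by
  have h2 := two_eq_zero F
  have hfin : {l | l ∈ A ∧ l ≠ 0}.Finite := Set.toFinite _
  set s := hfin.toFinset with hsdef
  have hs : ∀ l, l ∈ s ↔ l ∈ A ∧ l ≠ 0 := fun l => hfin.mem_toFinset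
  have hscard : s.card = 7 := by
    rw [← Set.ncard_eq_toFinset_card _ hfin, ncard_ne_zero_of_card h.card]
  refine ⟨⟨nucleus F, Set.mem_insert _ _⟩, ?_, ?_⟩
  · intro huniv
    have hne : (![1, 0, 0] : Fin 3 → F) ≠ 0 := vec_ne_zero_of_fst one_ne_zero
    have h1 : Projectivization.mk F _ hne ∈ arc (normalFamily A m) := huniv ▸ Set.mem_univ _
    rw [mk_mem_arc_iff] at h1
    rcases h1 with h1 | ⟨_, ⟨l, hl, rfl⟩, h1⟩ <;> simp [conicForm] at h1
  · intro L
    have hcount := h.ncard_inter_line hodd s hs L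
    induction L using Projectivization.ind with
    | h w hw =>
      have hmem : ∀ v (hv : v ≠ 0), Projectivization.mk F v hv ∈ line (Projectivization.mk F w hw) ↔
          v 0 * w 0 + v 1 * w 1 + v 2 * w 2 = 0 := fun v hv => mem_line_iff hv hw
      have hnuc : nucleus F ∈ line (Projectivization.mk F w hw) ↔ w 2 = 0 := by
        rw [nucleus, hmem]
        simp
      by_cases hw2 : w 2 = 0
      · right
        have hin : nucleus F ∈ arc (normalFamily A m) ∩ line (Projectivization.mk F w hw) :=
          ⟨Set.mem_insert _ _, hnuc.2 hw2⟩
        rw [Finset.sum_congr rfl fun l hl => ncard_conic_inter_line_nucleus ((hs l).1 hl).2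
          (u := w 0) (v := w 1) (fun h0 => hw (by
            ext i
            fin_cases i
            exacts [h0.1, h0.2, hw2])) _ (fun v hv => by
              rw [hmem, hw2, mul_zero, add_zero, mul_comm (v 0), mul_comm (v 1)]),
          Finset.sum_const, smul_eq_mul, mul_one, hscard,
          Set.ncard_sdiff_singleton_of_mem hin] at hcount
        omega
      · rw [Set.sdiff_singleton_eq_self fun h0 => hw2 (hnuc.1 h0.2)] at hcount
        set u := w 0 / w 2 with hu
        set v := w 1 / w 2 with hv
        let f : F → ZMod 2 := fun l => Tr (l * v ^ 2 + u ^ 2 * (l ^ 4 + m * l ^ 2 + l) + l * u * v)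
        have hf : ∀ x ∈ A, ∀ y ∈ A, f (x + y) = f x + f y := by
          intro x _ y _
          simp only [f]
          rw [← map_add]
          congr 1
          grind
        have htr : ∀ l ∈ s, Tr ((1 + l * u ^ 2) * (l ^ 3 + m * l + 1 + l * v ^ 2)) = 1 + f l := by
          intro l hl
          have e : (1 + l * u ^ 2) * (l ^ 3 + m * l + 1 + l * v ^ 2) =
              (l ^ 3 + m * l) + 1 + (l * v ^ 2 + u ^ 2 * (l ^ 4 + m * l ^ 2 + l)) +
                (l * u * v) ^ 2 := by ring
          rw [e, map_add, map_add, map_add, h.trace_eq_zero l ((hs l).1 hl).1, trace_one hodd,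
            trace_sq, zero_add, add_assoc, ← map_add]
        have hsum : ∀ l ∈ s, (conic 1 (l ^ 3 + m * l + 1) l ∩
            line (Projectivization.mk F w hw)).ncard = if f l = 1 then 2 else 0 := by
          intro l hl
          rw [ncard_conic_inter_line 1 (l ^ 3 + m * l + 1) l u v _ ?_, htr l hl]
          · have : ∀ x : ZMod 2, 1 + x = 0 ↔ x = 1 := by decide
            simp only [this]
          · intro x hx
            rw [hmem, hu, hv]
            field_simp
            constructor <;> intro h0 <;> grind
        rw [Finset.sum_congr rfl hsum, ← Finset.sum_filter, Finset.sum_const, smul_eq_mul] at hcount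
        have hfilter : ((s.filter fun l => f l = 1 : Finset F) : Set F) =
            {l | l ∈ A ∧ f l = 1} := by
          ext l
          simp only [Finset.coe_filter, hs, Set.mem_ofPred_eq]
          constructor
          · rintro ⟨⟨h1, -⟩, h3⟩
            exact ⟨h1, h3⟩
          · rintro ⟨h1, h3⟩
            refine ⟨⟨h1, ?_⟩, h3⟩
            rintro rfl
            simp [f] at h3
        rw [← Set.ncard_coe_finset, hfilter] at hcount
        rcases ncard_eq_one_of_additive h.card f hf with h0 | h0 <;> rw [h0] at hcount <;> omega

/-- The closed set of conics of a normal pair. -/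
theorem IsNormalPair.isMathonType (hodd : Odd (Module.finrank (ZMod 2) F))
    (h : IsNormalPair A m) : IsMathonType (arc (normalFamily A m)) := by
  have h2 := two_eq_zero F
  let C : ∀ l, l ∈ A → l ≠ 0 → MathonConic F := fun l hl hl0 =>
    ⟨1, l ^ 3 + m * l + 1, l, hl0, by
      rw [one_mul, map_add, h.trace_eq_zero l hl, trace_one hodd, zero_add]⟩
  refine ⟨{D | ∃ l hl hl0, D = C l hl hl0}, ?_, ?_⟩
  · rintro _ ⟨l, hl, hl0, rfl⟩ _ ⟨l', hl', hl0', rfl⟩ hne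
    have hll : l ≠ l' := by
      rintro rfl
      exact hne rfl
    have hs : l + l' ≠ 0 := fun h0 => hll (add_eq_zero_iff_eq_two.1 h0)
    refine ⟨C (l + l') (A.add_mem hl hl') hs, ⟨l + l', A.add_mem hl hl', hs, rfl⟩, hll, ?_, ?_,
      rfl⟩ <;>
      simp only [C] <;> field_simp
    grind
  · convert Isomorphic.refl _ using 1
    ext P
    induction P using Projectivization.ind with
    | h v hv =>
      rw [mk_mem_arc_iff, arcPoints, Set.mem_insert_iff, mk_eq_nucleus_iff]
      refine or_congr_right ?_
      simp only [Set.mem_iUnion, MathonConic.points, exists_prop]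
      constructor
      · rintro ⟨_, ⟨l, hl, rfl⟩, h1⟩
        exact ⟨_, ⟨l, hl.1, hl.2, rfl⟩, (mk_mem_conic_iff (1, _, l) v hv).2 h1⟩
      · rintro ⟨_, ⟨l, hl, hl0, rfl⟩, h1⟩
        exact ⟨_, ⟨l, ⟨hl, hl0⟩, rfl⟩, (mk_mem_conic_iff (1, _, l) v hv).1 h1⟩

theorem IsNormalPair.isProperMathonArc (hodd : Odd (Module.finrank (ZMod 2) F))
    (hq : 32 ≤ Nat.card F) (h : IsNormalPair A m) :
    IsProperMathonArc 8 (arc (normalFamily A m)) :=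
  ⟨h.isMaximalArc hodd, h.isMathonType hodd, not_isDennistonType_normal hq h.card m⟩

end NormalMaximal

/-! ### Closed sets of seven conics -/

section Closed

variable {F : Type*} [Field F]

theorem IsCollineation.injective {φ : PG2 F → PG2 F} (hφ : IsCollineation φ) :
    Function.Injective φ := by
  obtain ⟨ψ, -, hψ⟩ := hφ.exists_inverse
  exact Function.LeftInverse.injective (g := ψ) (congrFun hψ)

/-- Collineations map lines to lines. -/
theorem IsCollineation.exists_image_line {φ : PG2 F → PG2 F} (hφ : IsCollineation φ)
    (L : ℙ F (Fin 3 → F)) : ∃ L', φ '' line L = line L' := by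
  obtain ⟨σ, T, hT, rfl⟩ := hφ
  have := RingHomInvPair.of_ringEquiv σ
  have := RingHomInvPair.of_ringEquiv_symm σ
  let R : (Fin 3 → F) →ₛₗ[(σ.symm : F →+* F)] (Fin 3 → F) := (LinearEquiv.ofBijective T hT).symm
  have hRT : ∀ v, R (T v) = v := (LinearEquiv.ofBijective T hT).symm_apply_apply
  induction L using Projectivization.ind with
  | h w hw =>
    -- the functional `v ↦ v ⬝ᵥ w`, transported by `T`, has the coefficients `k i`
    let k : Fin 3 → F := fun i => σ (∑ j, R (Pi.single i 1) j * w j)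
    have hk : ∀ v, T v 0 * k 0 + T v 1 * k 1 + T v 2 * k 2 =
        σ (v 0 * w 0 + v 1 * w 1 + v 2 * w 2) := by
      intro v
      have e0 : (Pi.single 0 1 : Fin 3 → F) = ![1, 0, 0] := by ext i; fin_cases i <;> rfl
      have e1 : (Pi.single 1 1 : Fin 3 → F) = ![0, 1, 0] := by ext i; fin_cases i <;> rfl
      have e2 : (Pi.single 2 1 : Fin 3 → F) = ![0, 0, 1] := by ext i; fin_cases i <;> rfl
      conv_rhs => rw [← hRT v, semilinear_apply R (T v) 0, semilinear_apply R (T v) 1,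
        semilinear_apply R (T v) 2]
      simp only [k, e0, e1, e2, Fin.sum_univ_three, map_add, map_mul, RingEquiv.apply_symm_apply]
      ring
    have hk0 : k ≠ 0 := by
      intro h0
      apply hw
      ext i
      have := hk (Pi.single i 1)
      rw [h0] at this
      simp only [Pi.zero_apply, mul_zero, add_zero] at this
      have := (map_eq_zero_iff _ σ.injective).1 this.symm
      fin_cases i <;> simpa using this
    refine ⟨Projectivization.mk F k hk0, ?_⟩
    ext P
    constructor
    · rintro ⟨Q, hQ, rfl⟩
      induction Q using Projectivization.ind with
      | h v hv =>
        rw [mem_line_iff] at hQ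
        rw [Projectivization.map_mk, mem_line_iff, hk, hQ, map_zero]
    · intro hP
      induction P using Projectivization.ind with
      | h v hv =>
        obtain ⟨u, rfl⟩ := hT.2 v
        have hu : u ≠ 0 := by rintro rfl; exact hv (map_zero T)
        rw [mem_line_iff, hk, map_eq_zero_iff _ σ.injective] at hP
        exact ⟨Projectivization.mk F u hu, (mem_line_iff hu hw).2 hP,
          Projectivization.map_mk _ _ _ _⟩

theorem IsMaximalArc.ncard_of_isomorphic {d : ℕ} {K K' : Set (PG2 F)} (hK : IsMaximalArc d K)
    (h : Isomorphic K' K) (L : ℙ F (Fin 3 → F)) :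
    (K' ∩ line L).ncard = 0 ∨ (K' ∩ line L).ncard = d := by
  obtain ⟨φ, hφ, rfl⟩ := h
  obtain ⟨L', hL'⟩ := hφ.exists_image_line L
  rw [← Set.ncard_image_of_injective _ hφ.injective, Set.image_inter hφ.injective, hL']
  exact hK.2.2 L'

variable [Algebra (ZMod 2) F]

local notation "Tr" => Algebra.trace (ZMod 2) _

variable {𝒞 : Set (MathonConic F)}

theorem IsClosedSet.eq_of_l_eq (h : IsClosedSet 𝒞) {C C' : MathonConic F} (hC : C ∈ 𝒞)
    (hC' : C' ∈ 𝒞) (hl : C.l = C'.l) : C = C' := by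
  by_contra hne
  obtain ⟨D, -, hD⟩ := h C hC C' hC' hne
  exact hD.1 hl

/-- The line `y = 0` meets the conics of a closed set in different points. -/
theorem IsClosedSet.eq_of_mul_eq [Finite F] (h : IsClosedSet 𝒞) {C C' : MathonConic F} (hC : C ∈ 𝒞)
    (hC' : C' ∈ 𝒞) (hα : C.α * C'.l = C'.α * C.l) : C = C' := by
  have h2 := two_eq_zero F
  by_contra hne
  obtain ⟨D, -, hl, hDα, hDβ, -⟩ := h C hC C' hC' hne
  have hs : C.l + C'.l ≠ 0 := fun h0 => hl (add_eq_zero_iff_eq_two.1 h0)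
  have e : D.α * D.β = C.α * C.β + C'.α * C'.β := by
    rw [hDα, hDβ]
    field_simp
    grind
  have h1 := D.trace_eq_one
  rw [e, map_add, C.trace_eq_one, C'.trace_eq_one] at h1
  exact absurd h1 (by decide)

variable [Finite F]

/-- The line `y = 0` meets the arc of a closed set in the nucleus and one point for each conic. -/
theorem IsClosedSet.ncard_eq_seven (h : IsClosedSet 𝒞) {K : Set (PG2 F)} (hK : IsMaximalArc 8 K)
    (hiso : Isomorphic (arcPoints 𝒞) K) : 𝒞.ncard = 7 := by
  have h2 := two_eq_zero F
  have hw : (![0, 1, 0] : Fin 3 → F) ≠ 0 := vec_ne_zero_of_snd one_ne_zero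
  choose z hz using fun C : MathonConic F => exists_sq_eq (C.α / C.l)
  have hv : ∀ C, (![1, 0, z C] : Fin 3 → F) ≠ 0 := fun C => vec_ne_zero_of_fst one_ne_zero
  have hset : arcPoints 𝒞 ∩ line (Projectivization.mk F _ hw) =
      insert (nucleus F) ((fun C => Projectivization.mk F _ (hv C)) '' 𝒞) := by
    ext P
    induction P using Projectivization.ind with
    | h v hv0 =>
      rw [Set.mem_inter_iff, mem_line_iff, arcPoints, Set.mem_insert_iff, Set.mem_insert_iff,
        mk_eq_nucleus_iff]
      simp only [Set.mem_iUnion, MathonConic.points, mk_mem_conic, exists_prop, Set.mem_image,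
        Projectivization.mk_eq_mk_iff', Matrix.cons_val_zero, Matrix.cons_val_one,
        Matrix.cons_val, mul_zero, mul_one, add_zero, zero_add]
      constructor
      · rintro ⟨h0 | ⟨C, hC, h0⟩, hy⟩
        · exact Or.inl h0
        · by_cases hx : v 0 = 0
          · exact Or.inl ⟨hx, hy⟩
          · refine Or.inr ⟨C, hC, 1 / v 0, ?_⟩
            have hzC := hz C
            rw [eq_div_iff C.l_ne_zero] at hzC
            have : C.l * (v 2 + v 0 * z C) ^ 2 = 0 := by grind
            have : v 2 + v 0 * z C = 0 := by simpa [C.l_ne_zero] using this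
            have hv2 : v 2 = v 0 * z C := add_eq_zero_iff_eq_two.1 this
            ext i
            fin_cases i <;> simp [hy, hv2, hx]
      · rintro (h0 | ⟨C, hC, r, hr⟩)
        · exact ⟨Or.inl h0, h0.2⟩
        · have hzC := hz C
          rw [eq_div_iff C.l_ne_zero] at hzC
          have h0 := congrFun hr 0
          have h1 := congrFun hr 1
          have h3 := congrFun hr 2
          simp only [Pi.smul_apply, smul_eq_mul, Matrix.cons_val_zero, Matrix.cons_val_one,
            Matrix.cons_val] at h0 h1 h3
          refine ⟨Or.inr ⟨C, hC, ?_⟩, ?_⟩ <;> grind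
  have hinj : Set.InjOn (fun C => Projectivization.mk F _ (hv C)) 𝒞 := by
    intro C hC C' hC' he
    simp only [Projectivization.mk_eq_mk_iff'] at he
    obtain ⟨r, hr⟩ := he
    have h0 := congrFun hr 0
    have h3 := congrFun hr 2
    simp only [Pi.smul_apply, smul_eq_mul, Matrix.cons_val_zero, Matrix.cons_val, mul_one] at h0 h3
    rw [h0, one_mul] at h3
    have e := hz C
    rw [← h3, hz C', div_eq_div_iff C'.l_ne_zero C.l_ne_zero] at e
    exact h.eq_of_mul_eq hC hC' e.symm
  have hnot : nucleus F ∉ (fun C => Projectivization.mk F _ (hv C)) '' 𝒞 := by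
    rintro ⟨C, -, hC⟩
    rw [mk_eq_nucleus_iff] at hC
    exact one_ne_zero hC.1
  have hinjC : Function.Injective fun C : MathonConic F => (C.α, C.β, C.l) := by
    intro C C' he
    simp only [Prod.mk.injEq] at he
    exact MathonConic.ext he.1 he.2.1 he.2.2
  have : Finite (MathonConic F) := Finite.of_injective _ hinjC
  have hcount := hK.ncard_of_isomorphic hiso (Projectivization.mk F _ hw)
  rw [hset, Set.ncard_insert_of_notMem hnot (Set.toFinite _), hinj.ncard_image]
    at hcount
  omega

theorem finrank_eq_three {A : Submodule (ZMod 2) F} (hA : Nat.card A = 8) :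
    Module.finrank (ZMod 2) A = 3 := by
  have h := Module.natCard_eq_pow_finrank (K := ZMod 2) (V := A)
  rw [hA, Nat.card_zmod, show 8 = 2 ^ 3 by norm_num] at h
  exact (Nat.pow_right_injective le_rfl h).symm

/-- On a group of order eight every additive function is given by a polynomial
`c₀ x + c₁ x² + c₂ x⁴`. -/
theorem exists_additive_polynomial {A : Submodule (ZMod 2) F} (hA : Nat.card A = 8) (f : F → F)
    (hf : ∀ x ∈ A, ∀ y ∈ A, f (x + y) = f x + f y) :
    ∃ c : Fin 3 → F, ∀ x ∈ A, f x = c 0 * x + c 1 * x ^ 2 + c 2 * x ^ 4 := by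
  have h2 := two_eq_zero F
  let b := Module.finBasisOfFinrankEq (ZMod 2) A (finrank_eq_three hA)
  let E : (Fin 3 → F) → A →ₗ[ZMod 2] F := fun c =>
    (AddMonoidHom.mk' (fun x : A => c 0 * (x : F) + c 1 * (x : F) ^ 2 + c 2 * (x : F) ^ 4)
      (fun x y => by simp only [Submodule.coe_add]; grind)).toZModLinearMap 2
  let g : A →ₗ[ZMod 2] F :=
    (AddMonoidHom.mk' (fun x : A => f x) (fun x y => hf x x.2 y y.2)).toZModLinearMap 2
  have hE : ∀ c (x : A), E c x = c 0 * (x : F) + c 1 * (x : F) ^ 2 + c 2 * (x : F) ^ 4 :=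
    fun _ _ => rfl
  let Φ : (Fin 3 → F) →ₗ[F] (Fin 3 → F) :=
    { toFun := fun c i => E c (b i)
      map_add' := fun c d => by
        ext i
        simp only [hE, Pi.add_apply]
        ring
      map_smul' := fun r c => by
        ext i
        simp only [hE, Pi.smul_apply, smul_eq_mul, RingHom.id_apply]
        ring }
  have hinj : Function.Injective Φ := by
    rw [injective_iff_map_eq_zero]
    intro c hc
    have hEc : E c = 0 := b.ext fun i => congrFun hc i
    have hfin : (A : Set F).Finite := Set.toFinite _
    have hz := quartic_coeff_eq_zero hfin.toFinset (by
      rw [← Set.ncard_eq_toFinset_card _ hfin, show (A : Set F).ncard = 8 from hA]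
      norm_num) ![0, c 0, c 1, 0, c 2] (by
      intro s hs
      rw [hfin.mem_toFinset] at hs
      have : E c ⟨s, hs⟩ = 0 := by rw [hEc]; rfl
      rw [hE] at this
      simp only [Matrix.cons_val_zero, Matrix.cons_val_one, Matrix.cons_val]
      linear_combination this)
    ext i
    fin_cases i
    exacts [hz 1, hz 2, hz 4]
  obtain ⟨c, hc⟩ := LinearMap.injective_iff_surjective.1 hinj fun i => g (b i)
  have hg : E c = g := b.ext fun i => congrFun hc i
  exact ⟨c, fun x hx => (congrArg (fun k : A →ₗ[ZMod 2] F => k ⟨x, hx⟩) hg).symm⟩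

/-- The value at `l` of the function `c₀ + c₁ l + c₂ l³`, which becomes additive when multiplied
by `l`. -/
def evalCubic (c : Fin 3 → F) (l : F) : F := c 0 + c 1 * l + c 2 * l ^ 3

/-- The conics `F_{α,β,l}`, for the nonzero elements `l` of `A`, where `α` and `β` are the functions
of `l` with the coefficients `a` and `b`. -/
def cubicFamily (A : Submodule (ZMod 2) F) (a b : Fin 3 → F) : Set (F × F × F) :=
  (fun l => (evalCubic a l, evalCubic b l, l)) '' {l | l ∈ A ∧ l ≠ 0}

/-- Closed sets of seven conics are given by polynomials. -/
theorem exists_cubicFamily {K : Set (PG2 F)} (hK : IsMaximalArc 8 K) (hM : IsMathonType K) :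
    ∃ (A : Submodule (ZMod 2) F) (a b : Fin 3 → F), Nat.card A = 8 ∧
      (∀ l ∈ A, l ≠ 0 → Tr (evalCubic a l * evalCubic b l) = 1) ∧
      Isomorphic (arc (cubicFamily A a b)) K := by
  obtain ⟨𝒞, h𝒞, hiso⟩ := hM
  have h7 := h𝒞.ncard_eq_seven hK hiso
  let A : Submodule (ZMod 2) F :=
    { carrier := {x | x = 0 ∨ ∃ C ∈ 𝒞, C.l = x}
      zero_mem' := Or.inl rfl
      add_mem' := by
        rintro x y (rfl | ⟨C, hC, rfl⟩) (rfl | ⟨C', hC', rfl⟩)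
        · exact Or.inl (add_zero 0)
        · exact Or.inr ⟨C', hC', (zero_add _).symm⟩
        · exact Or.inr ⟨C, hC, (add_zero _).symm⟩
        · by_cases hne : C = C'
          · rw [hne]
            exact Or.inl (add_self_zero _)
          · obtain ⟨D, hD, hcomp⟩ := h𝒞 C hC C' hC' hne
            exact Or.inr ⟨D, hD, hcomp.2.2.2⟩
      smul_mem' := by
        intro r x hx
        have : ∀ r : ZMod 2, r = 0 ∨ r = 1 := by decide
        rcases this r with rfl | rfl
        · exact Or.inl (zero_smul _ _)
        · rwa [one_smul] }
  have hmem : ∀ x, x ∈ A ↔ x = 0 ∨ ∃ C ∈ 𝒞, C.l = x := fun x => Iff.rfl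
  have hA : Nat.card A = 8 := by
    have : (A : Set F) = insert 0 (MathonConic.l '' 𝒞) := rfl
    change (A : Set F).ncard = 8
    rw [this, Set.ncard_insert_of_notMem, Set.InjOn.ncard_image, h7]
    · exact fun C hC C' hC' hl => h𝒞.eq_of_l_eq hC hC' hl
    · rintro ⟨C, -, hC⟩
      exact C.l_ne_zero hC
  have hfun : ∀ l, ∃ a b, (l = 0 → a = 0 ∧ b = 0) ∧
      (l ∈ A → l ≠ 0 → ∃ C ∈ 𝒞, C.l = l ∧ a = C.α * l ∧ b = C.β * l) := by
    intro l
    by_cases hl : l ∈ A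
    · by_cases hl0 : l = 0
      · exact ⟨0, 0, fun _ => ⟨rfl, rfl⟩, fun _ h0 => absurd hl0 h0⟩
      · obtain ⟨C, hC, hCl⟩ := ((hmem l).1 hl).resolve_left hl0
        exact ⟨_, _, fun h0 => absurd h0 hl0, fun _ _ => ⟨C, hC, hCl, rfl, rfl⟩⟩
    · exact ⟨0, 0, fun _ => ⟨rfl, rfl⟩, fun h0 => absurd h0 hl⟩
  choose a b hab0 hab using hfun
  have hadd : ∀ x ∈ A, ∀ y ∈ A, a (x + y) = a x + a y ∧ b (x + y) = b x + b y := by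
    intro x hx y hy
    by_cases hx0 : x = 0
    · have := hab0 x hx0
      rw [this.1, this.2, hx0]
      simp
    by_cases hy0 : y = 0
    · have := hab0 y hy0
      rw [this.1, this.2, hy0]
      simp
    by_cases hxy : x = y
    · rw [hxy, add_self_zero, add_self_zero, add_self_zero]
      exact hab0 0 rfl
    have hs : x + y ≠ 0 := fun h0 => hxy (add_eq_zero_iff_eq_two.1 h0)
    obtain ⟨C, hC, hCl, ha, hb⟩ := hab x hx hx0
    obtain ⟨C', hC', hCl', ha', hb'⟩ := hab y hy hy0
    obtain ⟨D', hD', hDl', hDa', hDb'⟩ := hab (x + y) (A.add_mem hx hy) hs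
    obtain ⟨D, hD, hcomp⟩ := h𝒞 C hC C' hC' (by rintro rfl; exact hxy (hCl.symm.trans hCl'))
    have hDD : D' = D := h𝒞.eq_of_l_eq hD' hD (by rw [hDl', hcomp.2.2.2, hCl, hCl'])
    rw [hDD, hcomp.2.1, hCl, hCl', div_mul_cancel₀ _ hs] at hDa'
    rw [hDD, hcomp.2.2.1, hCl, hCl', div_mul_cancel₀ _ hs] at hDb'
    exact ⟨by rw [hDa', ha, ha'], by rw [hDb', hb, hb']⟩
  obtain ⟨ca, hca⟩ := exists_additive_polynomial hA a fun x hx y hy => (hadd x hx y hy).1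
  obtain ⟨cb, hcb⟩ := exists_additive_polynomial hA b fun x hx y hy => (hadd x hx y hy).2
  have hconic : ∀ C ∈ 𝒞, C.α = evalCubic ca C.l ∧ C.β = evalCubic cb C.l := by
    intro C hC
    have hl : C.l ∈ A := Or.inr ⟨C, hC, rfl⟩
    obtain ⟨D, hD, hDl, ha, hb⟩ := hab C.l hl C.l_ne_zero
    rw [h𝒞.eq_of_l_eq hD hC hDl] at ha hb
    rw [hca _ hl] at ha
    rw [hcb _ hl] at hb
    refine ⟨mul_right_cancel₀ C.l_ne_zero ?_, mul_right_cancel₀ C.l_ne_zero ?_⟩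
    · rw [← ha, evalCubic]
      ring
    · rw [← hb, evalCubic]
      ring
  refine ⟨A, ca, cb, hA, ?_, ?_⟩
  · intro l hl hl0
    obtain ⟨C, hC, rfl⟩ := ((hmem l).1 hl).resolve_left hl0
    rw [← (hconic C hC).1, ← (hconic C hC).2]
    exact C.trace_eq_one
  · convert hiso using 1
    rw [arc, arcPoints]
    congr 1
    ext P
    simp only [Set.mem_iUnion, exists_prop]
    constructor
    · rintro ⟨_, ⟨l, hl, rfl⟩, hP⟩
      obtain ⟨C, hC, rfl⟩ := ((hmem l).1 hl.1).resolve_left hl.2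
      refine ⟨C, hC, ?_⟩
      rwa [MathonConic.points, (hconic C hC).1, (hconic C hC).2]
    · rintro ⟨C, hC, hP⟩
      refine ⟨_, ⟨C.l, ⟨Or.inr ⟨C, hC, rfl⟩, C.l_ne_zero⟩, rfl⟩, ?_⟩
      rw [MathonConic.points, (hconic C hC).1, (hconic C hC).2] at hP
      exact hP

end Closed

/-! ### Reduction to normal form -/

section Reduction

variable {F : Type*} [Field F] [Algebra (ZMod 2) F] [Finite F]
  {A : Submodule (ZMod 2) F}

local notation "Tr" => Algebra.trace (ZMod 2) _

theorem IsDennistonType.of_isomorphic {F : Type*} [Field F] [Algebra (ZMod 2) F]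
    {K K' : Set (PG2 F)} (hK : IsDennistonType K)
    (h : Isomorphic K K') : IsDennistonType K' := by
  obtain ⟨α, B, h1, h3, h4, h5⟩ := hK
  exact ⟨α, B, h1, h3, h4, h5.trans h⟩

theorem not_forall_eq_one_of_additive (hA : Nat.card A = 8) (f : F → ZMod 2)
    (hf : ∀ x ∈ A, ∀ y ∈ A, f (x + y) = f x + f y) : ¬ ∀ l ∈ A, l ≠ 0 → f l = 1 := by
  intro h
  have h0 : f 0 = 0 := by simpa using hf 0 A.zero_mem 0 A.zero_mem
  have he : {l | l ∈ A ∧ f l = 1} = {l | l ∈ A ∧ l ≠ 0} := by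
    ext l
    refine and_congr_right fun hl => ⟨?_, h l hl⟩
    rintro h1 rfl
    rw [h0] at h1
    exact zero_ne_one h1
  have := ncard_eq_one_of_additive hA f hf
  rw [he, ncard_ne_zero_of_card hA] at this
  omega

/-- A quadratic function on a group of order eight cannot take the value `1` at all nonzero
elements: its seven values there sum to zero. -/
theorem exists_trace_cubic_ne_one (hA : Nat.card A = 8) (κ m : F) :
    ∃ l ∈ A, l ≠ 0 ∧ Tr (κ * l ^ 3 + m * l) ≠ 1 := by
  classical
  have h2 := two_eq_zero F
  by_contra! hall
  have hA8 : (A : Set F).ncard = 8 := hA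
  have hnot : ∀ s : Finset F, s.card < 8 → ∃ x ∈ A, x ∉ s := fun s hs =>
    Set.exists_mem_notMem_of_ncard_lt_ncard (s := (s : Set F)) (t := A)
      (by rw [Set.ncard_coe_finset, hA8]; exact hs) (Set.toFinite _)
  obtain ⟨x, hx, hx'⟩ := hnot {0} (by simp)
  obtain ⟨y, hy, hy'⟩ := hnot {0, x} (Finset.card_le_two.trans_lt (by norm_num))
  obtain ⟨z, hz, hz'⟩ := hnot {0, x, y, x + y} (Finset.card_le_four.trans_lt (by norm_num))
  simp only [Finset.mem_insert, Finset.mem_singleton, not_or] at hx' hy' hz'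
  have e : (κ * (x + y + z) ^ 3 + m * (x + y + z)) =
      (κ * (x + y) ^ 3 + m * (x + y)) + (κ * (x + z) ^ 3 + m * (x + z)) +
      (κ * (y + z) ^ 3 + m * (y + z)) + (κ * x ^ 3 + m * x) + (κ * y ^ 3 + m * y) +
      (κ * z ^ 3 + m * z) := by grind
  have h1 := congrArg (Algebra.trace (ZMod 2) F) e
  simp only [map_add (Algebra.trace (ZMod 2) F) (_ + _),
    map_add (Algebra.trace (ZMod 2) F) (_ * _ ^ 3)] at h1
  simp only [← map_add (Algebra.trace (ZMod 2) F) (_ * _ ^ 3)] at h1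
  rw [hall _ (A.add_mem (A.add_mem hx hy) hz) (by grind), hall _ (A.add_mem hx hy) (by grind),
    hall _ (A.add_mem hx hz) (by grind), hall _ (A.add_mem hy hz) (by grind), hall x hx (by grind),
    hall y hy (by grind), hall z hz (by grind)] at h1
  exact absurd h1 (by decide)

theorem isomorphic_cubicFamily_swap (a b : Fin 3 → F) :
    Isomorphic (arc (cubicFamily A a b)) (arc (cubicFamily A b a)) := by
  let T : Substitution F := ⟨RingEquiv.refl F, 0, 1, 1, 0, 0, 0, 1, by simp, one_ne_zero⟩
  have hrel : ∀ x y l, T.Rel (x, y, l) (y, x, l) := fun x y l => by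
    refine ⟨?_, ?_, ?_⟩ <;> simp [T]
  refine T.isomorphic_arc ?_ ?_
  · rintro _ ⟨l, hl, rfl⟩
    exact ⟨_, ⟨l, hl, rfl⟩, hrel _ _ _⟩
  · rintro _ ⟨l, hl, rfl⟩
    exact ⟨_, ⟨l, hl, rfl⟩, hrel _ _ _⟩

/-- If the direction `(1, τ)` annihilates the coefficients of `l³`, then the restriction of the
forms `α x² + x y + β y²` to it is a linear polynomial `v + k l` in `l`. The constant `v` is not
zero, since otherwise `Tr (k l β)` would be a function additive on `A` that is `1` at all nonzero
elements. So the direction can be scaled to make the coefficient of `x²` equal to `1 + (k / v) l`,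
and a translation of `z` by a multiple of `x` makes it `1`; a multiple of `y` is added in order to
keep the trace condition. -/
theorem exists_cubicFamily_one_of_direction (hA : Nat.card A = 8) {a b : Fin 3 → F}
    (htr : ∀ l ∈ A, l ≠ 0 → Tr (evalCubic a l * evalCubic b l) = 1) {τ : F}
    (hτ : a 2 + τ ^ 2 * b 2 = 0) :
    ∃ b' : Fin 3 → F, (∀ l ∈ A, l ≠ 0 → Tr (evalCubic b' l) = 1) ∧
      Isomorphic (arc (cubicFamily A ![1, 0, 0] b')) (arc (cubicFamily A a b)) := by
  have h2 := two_eq_zero F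
  set v := a 0 + τ + τ ^ 2 * b 0 with hv
  set k := a 1 + τ ^ 2 * b 1 with hk
  have hdir : ∀ l, evalCubic a l + τ + τ ^ 2 * evalCubic b l = v + k * l := by
    intro l
    simp only [evalCubic, hv, hk]
    grind
  have htr' : ∀ l ∈ A, l ≠ 0 → Tr ((v + k * l) * evalCubic b l) = 1 := by
    intro l hl hl0
    have e : (v + k * l) * evalCubic b l = evalCubic a l * evalCubic b l +
        (τ * evalCubic b l + (τ * evalCubic b l) ^ 2) := by
      rw [← hdir]
      ring
    rw [e, map_add, map_add, trace_sq, CharTwo.add_self_eq_zero, add_zero, htr l hl hl0]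
  have hadd : ∀ x ∈ A, ∀ y ∈ A, Tr (k * ((x + y) * evalCubic b (x + y))) =
      Tr (k * (x * evalCubic b x)) + Tr (k * (y * evalCubic b y)) := by
    intro x _ y _
    rw [← map_add]
    congr 1
    simp only [evalCubic]
    grind
  have hv0 : v ≠ 0 := by
    intro hv0
    refine not_forall_eq_one_of_additive hA
      (fun l => Tr (k * (l * evalCubic b l))) hadd fun l hl hl0 => ?_
    rw [← htr' l hl hl0, hv0]
    congr 1
    ring
  obtain ⟨n, hn⟩ := exists_trace_mul_eq A (fun l => Tr (k * (l * evalCubic b l))) hadd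
  obtain ⟨f, hf⟩ := exists_sq_eq n
  obtain ⟨r, hr⟩ := exists_sq_eq v
  have hr0 : r ≠ 0 := by
    rintro rfl
    exact hv0 (by rw [← hr]; ring)
  obtain ⟨e, he⟩ := exists_sq_eq (k / v)
  rw [eq_div_iff hv0] at he
  refine ⟨![v * b 0, v * b 1 + n, v * b 2], fun l hl hl0 => ?_, ?_⟩
  · have e1 : evalCubic ![v * b 0, v * b 1 + n, v * b 2] l =
        (v + k * l) * evalCubic b l + (k * (l * evalCubic b l) + n * l) := by
      simp only [evalCubic, Matrix.cons_val_zero, Matrix.cons_val_one, Matrix.cons_val]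
      grind
    rw [e1, map_add, map_add, hn l hl, CharTwo.add_self_eq_zero, add_zero, htr' l hl hl0]
  · let T : Substitution F := ⟨RingEquiv.refl F, 1 / r, 0, τ / r, r, e, f, 1, by simp [hr0],
      one_ne_zero⟩
    have hrel : ∀ l, T.Rel (evalCubic ![1, 0, 0] l,
        evalCubic ![v * b 0, v * b 1 + n, v * b 2] l, l) (evalCubic a l, evalCubic b l, l) := by
      intro l
      have hd := hdir l
      refine ⟨?_, ?_, ?_⟩
      · have h1 : evalCubic ![1, 0, 0] l = 1 := by simp [evalCubic]
        simp only [T, h1, map_one]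
        field_simp
        rw [hr]
        grind
      · simp only [T, RingEquiv.refl_apply]
        have h1 : 1 / r * r + 0 * (τ / r) = 1 := by field_simp; ring
        rw [h1, hr, hf]
        simp only [evalCubic, Matrix.cons_val_zero, Matrix.cons_val_one, Matrix.cons_val]
        ring
      · simp only [T, RingEquiv.refl_apply]
        field_simp
        ring
    refine T.isomorphic_arc ?_ ?_
    · rintro _ ⟨l, hl, rfl⟩
      exact ⟨_, ⟨l, hl, rfl⟩, hrel l⟩
    · rintro _ ⟨l, hl, rfl⟩
      exact ⟨_, ⟨l, hl, rfl⟩, hrel l⟩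

theorem exists_cubicFamily_one (hA : Nat.card A = 8) {a b : Fin 3 → F}
    (htr : ∀ l ∈ A, l ≠ 0 → Tr (evalCubic a l * evalCubic b l) = 1) :
    ∃ b' : Fin 3 → F, (∀ l ∈ A, l ≠ 0 → Tr (evalCubic b' l) = 1) ∧
      Isomorphic (arc (cubicFamily A ![1, 0, 0] b')) (arc (cubicFamily A a b)) := by
  by_cases hb : b 2 = 0
  · -- after interchanging `x` and `y`, the direction `(1, 0)` can be used
    obtain ⟨b', h1, h3⟩ := exists_cubicFamily_one_of_direction hA (a := b) (b := a) (τ := 0)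
      (fun l hl hl0 => by rw [mul_comm, htr l hl hl0]) (by simp [hb])
    exact ⟨b', h1, h3.trans (isomorphic_cubicFamily_swap b a)⟩
  · obtain ⟨τ, hτ⟩ := exists_sq_eq (a 2 / b 2)
    refine exists_cubicFamily_one_of_direction hA htr (τ := τ) ?_
    rw [hτ, div_mul_cancel₀ _ hb, add_self_zero]

/-- Without a term `l³`, the arc is of Denniston type. -/
theorem isDennistonType_of_coeff_eq_zero (hA : Nat.card A = 8) {b : Fin 3 → F}
    (htr : ∀ l ∈ A, l ≠ 0 → Tr (evalCubic b l) = 1) (hb : b 2 = 0) :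
    IsDennistonType (arc (cubicFamily A ![1, 0, 0] b)) := by
  have h2 := two_eq_zero F
  have hev : ∀ l, evalCubic b l = b 0 + b 1 * l := by
    intro l
    rw [evalCubic, hb, zero_mul, add_zero]
  obtain ⟨e, he⟩ := exists_sq_eq (b 1)
  refine ⟨b 0, {l | l ∈ A ∧ l ≠ 0}, ?_, fun h0 => h0.2 rfl, ?_, ?_⟩
  · by_contra hne
    have h0 : Tr (b 0) = 0 := by
      by_contra h0
      exact hne (zmod_two_eq_one_of_ne_zero h0)
    refine not_forall_eq_one_of_additive hA (fun l => Tr (b 1 * l))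
      (fun x _ y _ => by rw [mul_add, map_add]) fun l hl hl0 => ?_
    rw [← htr l hl hl0, hev, map_add, h0, zero_add]
  · have hmem : ∀ x, x ∈ insert 0 {l | l ∈ A ∧ l ≠ 0} ↔ x ∈ A := by
      intro x
      rw [Set.mem_insert_iff]
      constructor
      · rintro (rfl | hx)
        exacts [A.zero_mem, hx.1]
      · intro hx
        by_cases h0 : x = 0
        exacts [Or.inl h0, Or.inr ⟨hx, h0⟩]
    intro x hx y hy
    rw [hmem] at hx hy ⊢
    exact A.add_mem hx hy
  · have hD : insert (nucleus F) (⋃ l ∈ {l | l ∈ A ∧ l ≠ 0}, conic (b 0) 1 l) =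
        arc ((fun l => (b 0, 1, l)) '' {l | l ∈ A ∧ l ≠ 0}) := by
      simp [arc]
    rw [hD]
    let T : Substitution F := ⟨RingEquiv.refl F, 0, 1, 1, 0, e, 0, 1, by simp, one_ne_zero⟩
    have hrel : ∀ l, T.Rel (b 0, 1, l) (evalCubic ![1, 0, 0] l, evalCubic b l, l) := by
      intro l
      rw [hev]
      refine ⟨?_, ?_, ?_⟩ <;> simp [T, evalCubic]
      grind
    refine T.isomorphic_arc ?_ ?_
    · rintro _ ⟨l, hl, rfl⟩
      exact ⟨_, ⟨l, hl, rfl⟩, hrel l⟩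
    · rintro _ ⟨l, hl, rfl⟩
      exact ⟨_, ⟨l, hl, rfl⟩, hrel l⟩

/-- With a term `κ l³`, `κ ≠ 0`, scaling `l` by a cube root of `κ` gives the normal form. -/
theorem exists_normalFamily_of_coeff_ne_zero (hodd : Odd (Module.finrank (ZMod 2) F))
    (hA : Nat.card A = 8) {b : Fin 3 → F}
    (htr : ∀ l ∈ A, l ≠ 0 → Tr (evalCubic b l) = 1) (hb : b 2 ≠ 0) :
    ∃ (A' : Submodule (ZMod 2) F) (m : F), IsNormalPair A' m ∧
      Isomorphic (arc (normalFamily A' m)) (arc (cubicFamily A ![1, 0, 0] b)) := by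
  have h2 := two_eq_zero F
  obtain ⟨γ, hγ⟩ := exists_cube_eq hodd (b 2)
  have hγ0 : γ ≠ 0 := by
    rintro rfl
    exact hb (by rw [← hγ]; ring)
  have hev : ∀ l, evalCubic b l = ((γ * l) ^ 3 + b 1 / γ * (γ * l)) + b 0 := by
    intro l
    rw [evalCubic, ← hγ]
    field_simp
    ring
  have hb0 : Tr (b 0) = 1 := by
    refine zmod_two_eq_one_of_ne_zero fun h0 => ?_
    obtain ⟨l, hl, hl0, h1⟩ := exists_trace_cubic_ne_one hA (b 2) (b 1)
    apply h1
    rw [← htr l hl hl0, evalCubic, add_assoc, map_add _ (b 0), h0, zero_add, add_comm]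
  obtain ⟨t, ht⟩ := trace_eq_zero_iff.1
    (show Tr (b 0 + 1) = 0 by rw [map_add, hb0, trace_one hodd]; rfl)
  obtain ⟨g, hg⟩ := exists_sq_eq γ
  have hg0 : g ≠ 0 := by
    rintro rfl
    exact hγ0 (by rw [← hg]; ring)
  have hinj : Function.Injective (LinearMap.mulLeft (ZMod 2) γ) := fun x y h =>
    mul_left_cancel₀ hγ0 h
  refine ⟨A.map (LinearMap.mulLeft (ZMod 2) γ), b 1 / γ, ⟨?_, ?_⟩, ?_⟩
  · rw [← hA]
    exact (Nat.card_congr (A.equivMapOfInjective _ hinj).toEquiv).symm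
  · rintro _ ⟨l, hl, rfl⟩
    rw [LinearMap.mulLeft_apply]
    by_cases hl0 : l = 0
    · simp [hl0]
    · have h1 := htr l hl hl0
      rw [hev, map_add, hb0] at h1
      exact add_eq_right.1 h1
  · let T : Substitution F := ⟨RingEquiv.refl F, 1, t, 0, 1, 0, 0, g, by simp, hg0⟩
    have hrel : ∀ l, T.Rel (1, (γ * l) ^ 3 + b 1 / γ * (γ * l) + 1, γ * l)
        (evalCubic ![1, 0, 0] l, evalCubic b l, l) := by
      intro l
      have h1 : evalCubic ![1, 0, 0] l = 1 := by simp [evalCubic]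
      rw [hev, h1]
      refine ⟨by simp [T], ?_, ?_⟩
      · simp only [T, RingEquiv.refl_apply]
        grind
      · simp only [T, RingEquiv.refl_apply, hg]
        ring
    refine T.isomorphic_arc ?_ ?_
    · rintro _ ⟨_, ⟨⟨l, hl, rfl⟩, hl0⟩, rfl⟩
      exact ⟨_, ⟨l, ⟨hl, by rintro rfl; simp at hl0⟩, rfl⟩, hrel l⟩
    · rintro _ ⟨l, ⟨hl, hl0⟩, rfl⟩
      exact ⟨_, ⟨γ * l, ⟨⟨l, hl, rfl⟩, mul_ne_zero hγ0 hl0⟩, rfl⟩, hrel l⟩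

/-- Every proper Mathon arc of degree eight has a normal form. -/
theorem IsProperMathonArc.exists_isomorphic_normal (hodd : Odd (Module.finrank (ZMod 2) F))
    {K : Set (PG2 F)} (hK : IsProperMathonArc 8 K) :
    ∃ (A : Submodule (ZMod 2) F) (m : F), IsNormalPair A m ∧
      Isomorphic (arc (normalFamily A m)) K := by
  obtain ⟨A, a, b, hA, htr, hiso⟩ := exists_cubicFamily hK.1 hK.2.1
  obtain ⟨b', htr', hiso'⟩ := exists_cubicFamily_one hA htr
  have hb' : b' 2 ≠ 0 := fun h0 => hK.2.2
    ((isDennistonType_of_coeff_eq_zero hA htr' h0).of_isomorphic (hiso'.trans hiso))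
  obtain ⟨A', m, hpair, hiso''⟩ := exists_normalFamily_of_coeff_ne_zero hodd hA htr' hb'
  exact ⟨A', m, hpair, hiso''.trans (hiso'.trans hiso)⟩

end Reduction

/-! ### Counting totally isotropic subgroups of order eight -/

section Counting

variable {F : Type*} [Field F] [Algebra (ZMod 2) F]

local notation "Tr" => Algebra.trace (ZMod 2) _

/-- The alternating form `(x, y) ↦ Tr (x² y + x y²)`, the polarization of `x ↦ Tr (x³)`, as a linear
functional of `y`. -/
noncomputable def cubeForm (x : F) : F →ₗ[ZMod 2] ZMod 2 :=
  (AddMonoidHom.mk' (fun y : F => Tr (x ^ 2 * y + x * y ^ 2)) (fun y z => by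
    have h2 := two_eq_zero F
    rw [← map_add]
    congr 1
    grind)).toZModLinearMap 2

theorem cubeForm_apply (x y : F) : cubeForm x y = Tr (x ^ 2 * y + x * y ^ 2) := rfl

theorem cubeForm_comm (x y : F) : cubeForm x y = cubeForm y x := by
  rw [cubeForm_apply, cubeForm_apply]
  congr 1
  ring

theorem cubeForm_self (x : F) : cubeForm x x = 0 := by
  rw [cubeForm_apply, show x ^ 2 * x + x * x ^ 2 = x ^ 3 + x ^ 3 by ring, add_self_zero, map_zero]

theorem cubeForm_add (x y : F) : cubeForm (x + y) = cubeForm x + cubeForm y := by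
  ext z
  rw [LinearMap.add_apply, cubeForm_comm, map_add, cubeForm_comm z x, cubeForm_comm z y]

/-- The bases, in order, of totally isotropic subgroups of order eight. -/
def isotropicTriples (F : Type*) [Field F] [Algebra (ZMod 2) F] : Set (Fin 3 → F) :=
  {s | LinearIndependent (ZMod 2) s ∧ ∀ i j, cubeForm (s i) (s j) = 0}

theorem zmod_two_mem_span_pair {x y z : F} :
    z ∈ Submodule.span (ZMod 2) {x, y} ↔ z ∈ ({0, x, y, x + y} : Set F) := by
  rw [Submodule.mem_span_pair]
  have hz : ∀ r : ZMod 2, r = 0 ∨ r = 1 := by decide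
  constructor
  · rintro ⟨r, s, rfl⟩
    rcases hz r with rfl | rfl <;> rcases hz s with rfl | rfl <;> simp
  · rintro (rfl | rfl | rfl | rfl)
    exacts [⟨0, 0, by simp⟩, ⟨1, 0, by simp⟩, ⟨0, 1, by simp⟩, ⟨1, 1, by simp⟩]

theorem mem_isotropicTriples_iff {x y z : F} : ![z, y, x] ∈ isotropicTriples F ↔
    (x ≠ 0 ∧ y ≠ 0 ∧ x ≠ y ∧ cubeForm x y = 0) ∧
      z ∈ {z | cubeForm x z = 0 ∧ cubeForm y z = 0} \ ({0, x, y, x + y} : Set F) := by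
  have hli : LinearIndependent (ZMod 2) ![z, y, x] ↔
      (x ≠ 0 ∧ y ≠ 0 ∧ x ≠ y) ∧ z ∉ ({0, x, y, x + y} : Set F) := by
    rw [← zmod_two_mem_span_pair, Matrix.vecCons, linearIndependent_finCons,
      LinearIndependent.pair_iff]
    have hr : Set.range ![y, x] = {x, y} := by
      rw [Matrix.range_cons, Matrix.range_cons, Matrix.range_empty, Set.union_empty,
        Set.singleton_union, Set.pair_comm]
    rw [hr]
    refine and_congr_left fun _ => ?_
    have hz : ∀ r : ZMod 2, r = 0 ∨ r = 1 := by decide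
    constructor
    · intro h
      refine ⟨?_, ?_, ?_⟩
      · rintro rfl
        exact one_ne_zero (h 0 1 (by simp)).2
      · rintro rfl
        exact one_ne_zero (h 1 0 (by simp)).1
      · rintro rfl
        exact one_ne_zero (h 1 1 (by simp [add_self_zero])).1
    · rintro ⟨hx, hy, hxy⟩ r s hrs
      rcases hz r with rfl | rfl <;> rcases hz s with rfl | rfl
      · exact ⟨rfl, rfl⟩
      · exact absurd (by simpa using hrs) hx
      · exact absurd (by simpa using hrs) hy
      · rw [one_smul, one_smul] at hrs
        exact absurd (add_eq_zero_iff_eq_two.1 hrs).symm hxy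
  rw [isotropicTriples, Set.mem_ofPred_eq, hli, Set.mem_sdiff, Set.mem_ofPred_eq]
  have hB : (∀ i j, cubeForm (![z, y, x] i) (![z, y, x] j) = 0) ↔
      cubeForm x y = 0 ∧ cubeForm x z = 0 ∧ cubeForm y z = 0 := by
    simp only [Fin.forall_fin_succ, Matrix.cons_val_zero, Matrix.cons_val_succ,
      IsEmpty.forall_iff, and_true, cubeForm_self, true_and]
    rw [cubeForm_comm z y, cubeForm_comm z x, cubeForm_comm y x]
    tauto
  rw [hB]
  tauto

/-- A functional that does not vanish on `W` vanishes on half of `W`. -/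
theorem two_mul_ncard_ker [Finite F] (W : Submodule (ZMod 2) F) (f : F →ₗ[ZMod 2] ZMod 2) {k : F}
    (hk : k ∈ W) (hfk : f k ≠ 0) :
    2 * {x | x ∈ W ∧ f x = 0}.ncard = (W : Set F).ncard := by
  have hk1 := zmod_two_eq_one_of_ne_zero hfk
  have himg : (fun x => x + k) '' {x | x ∈ W ∧ f x = 0} = {x | x ∈ W ∧ f x = 1} := by
    ext x
    constructor
    · rintro ⟨y, ⟨hy, hy0⟩, rfl⟩
      exact ⟨W.add_mem hy hk, by rw [map_add, hy0, hk1, zero_add]⟩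
    · rintro ⟨hx, hx1⟩
      refine ⟨x + k, ⟨W.add_mem hx hk, by rw [map_add, hx1, hk1]; rfl⟩, ?_⟩
      simp only [add_assoc, add_self_zero, add_zero]
  have hun : {x | x ∈ W ∧ f x = 0} ∪ {x | x ∈ W ∧ f x = 1} = (W : Set F) := by
    ext x
    have : ∀ y : ZMod 2, y = 0 ∨ y = 1 := by decide
    simp only [Set.mem_union, Set.mem_ofPred_eq, ← and_or_left, SetLike.mem_coe, this, and_true]
  rw [← hun, Set.ncard_union_eq ?_ (Set.toFinite _) (Set.toFinite _), ← himg,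
    Set.ncard_image_of_injective _ (add_left_injective k), two_mul]
  rw [Set.disjoint_left]
  rintro x ⟨-, h0⟩ ⟨-, h1⟩
  rw [h0] at h1
  exact zero_ne_one h1

variable [Finite F]

/-- The radical of the form is `{0, 1}`. -/
theorem cubeForm_eq_zero_iff (hodd : Odd (Module.finrank (ZMod 2) F)) (x : F) :
    cubeForm x = 0 ↔ x = 0 ∨ x = 1 := by
  constructor
  · intro h
    obtain ⟨w, rfl⟩ := exists_sq_eq x
    have hnd : (Algebra.traceForm (ZMod 2) F).Nondegenerate := traceForm_nondegenerate (ZMod 2) F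
    have h0 : w ^ 4 + w = 0 := by
      refine hnd.1 _ fun y => ?_
      have h1 := LinearMap.congr_fun h y
      rw [cubeForm_apply, LinearMap.zero_apply, map_add,
        show w ^ 2 * y ^ 2 = (w * y) ^ 2 by ring, trace_sq, ← map_add] at h1
      rw [Algebra.traceForm_apply, ← h1]
      congr 1
      ring
    by_cases hw : w = 0
    · left
      rw [hw]
      ring
    · right
      have h3 : w * (w ^ 3 + 1) = 0 := by linear_combination h0
      have h4 := add_eq_zero_iff_eq_two.1 ((mul_eq_zero.1 h3).resolve_left hw)
      rw [eq_one_of_cube_eq_one hodd h4]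
      ring
  · rintro (rfl | rfl) <;> ext y <;> rw [cubeForm_apply, LinearMap.zero_apply]
    · simp
    · rw [one_pow, one_mul, one_mul, map_add, trace_sq]
      exact CharTwo.add_self_eq_zero _

theorem exists_ne_zero_of_cubeForm (hodd : Odd (Module.finrank (ZMod 2) F)) {x : F} (hx0 : x ≠ 0)
    (hx1 : x ≠ 1) : ∃ k, cubeForm x k ≠ 0 := by
  by_contra! h
  rcases (cubeForm_eq_zero_iff hodd x).1 (LinearMap.ext h) with h | h <;> contradiction

theorem two_mul_ncard_perp (hodd : Odd (Module.finrank (ZMod 2) F)) {x : F} (hx0 : x ≠ 0)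
    (hx1 : x ≠ 1) : 2 * {z | cubeForm x z = 0}.ncard = Nat.card F := by
  obtain ⟨k, hk⟩ := exists_ne_zero_of_cubeForm hodd hx0 hx1
  have := two_mul_ncard_ker ⊤ (cubeForm x) (Submodule.mem_top (x := k)) hk
  simpa [Set.ncard_univ] using this

theorem four_mul_ncard_perp (hodd : Odd (Module.finrank (ZMod 2) F)) {x y : F} (hx0 : x ≠ 0)
    (hx1 : x ≠ 1) (hy0 : y ≠ 0) (hy1 : y ≠ 1) (hxy : x ≠ y) (hxy1 : x + y ≠ 1) :
    4 * {z | cubeForm x z = 0 ∧ cubeForm y z = 0}.ncard = Nat.card F := by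
  obtain ⟨k, hk, hk1⟩ : ∃ k, cubeForm x k = 0 ∧ cubeForm y k ≠ 0 := by
    by_contra! h
    obtain ⟨u, hu⟩ := exists_ne_zero_of_cubeForm hodd hx0 hx1
    obtain ⟨u', hu'⟩ := exists_ne_zero_of_cubeForm hodd hy0 hy1
    obtain ⟨u'', hu''⟩ := exists_ne_zero_of_cubeForm hodd
      (fun h0 => hxy (add_eq_zero_iff_eq_two.1 h0)) hxy1
    have key : ∀ w, cubeForm y w = cubeForm x w * cubeForm y u := by
      intro w
      by_cases hw : cubeForm x w = 0
      · rw [h w hw, hw, zero_mul]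
      · have e1 := zmod_two_eq_one_of_ne_zero hw
        have e2 := h (w + u) (by rw [map_add, e1, zmod_two_eq_one_of_ne_zero hu]; rfl)
        rw [map_add] at e2
        rw [e1, one_mul]
        revert e2
        generalize cubeForm y w = s, cubeForm y u = t
        revert s t
        decide
    by_cases hyu : cubeForm y u = 0
    · exact hu' (by rw [key, hyu, mul_zero])
    · apply hu''
      rw [cubeForm_add, LinearMap.add_apply, key, zmod_two_eq_one_of_ne_zero hyu, mul_one]
      exact CharTwo.add_self_eq_zero _
  have h1 := two_mul_ncard_ker (LinearMap.ker (cubeForm x)) (cubeForm y) (k := k) hk hk1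
  have h2 := two_mul_ncard_perp hodd hx0 hx1
  rw [← h2]
  change 2 * {z | cubeForm x z = 0 ∧ cubeForm y z = 0}.ncard = {z | cubeForm x z = 0}.ncard at h1
  omega

/-- The number of `z` that extend a pair `x, y` to a basis of an isotropic subgroup of order
eight. -/
theorem ncard_third (hodd : Odd (Module.finrank (ZMod 2) F)) {x y : F}
    (hx0 : x ≠ 0) (hy0 : y ≠ 0) (hxy : x ≠ y) (hB : cubeForm x y = 0) :
    ((1 = x ∨ 1 = y ∨ 1 = x + y) →
      2 * ({z | cubeForm x z = 0 ∧ cubeForm y z = 0} \ {0, x, y, x + y}).ncard = Nat.card F - 8) ∧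
    (¬(1 = x ∨ 1 = y ∨ 1 = x + y) →
      4 * ({z | cubeForm x z = 0 ∧ cubeForm y z = 0} \ {0, x, y, x + y}).ncard =
        Nat.card F - 16) := by
  have h2 := two_eq_zero F
  have h4 : ({0, x, y, x + y} : Set F).ncard = 4 := by
    rw [Set.ncard_insert_of_notMem, Set.ncard_insert_of_notMem, Set.ncard_insert_of_notMem,
      Set.ncard_singleton] <;>
      simp only [Set.mem_insert_iff, Set.mem_singleton_iff, not_or] <;> grind
  have hsub : ({0, x, y, x + y} : Set F) ⊆ {z | cubeForm x z = 0 ∧ cubeForm y z = 0} := by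
    rintro z (rfl | rfl | rfl | rfl)
    · exact ⟨map_zero _, map_zero _⟩
    · exact ⟨cubeForm_self _, (cubeForm_comm _ _).trans hB⟩
    · exact ⟨hB, cubeForm_self _⟩
    · refine ⟨?_, ?_⟩ <;> rw [map_add, cubeForm_self]
      · rw [hB, add_zero]
      · rw [cubeForm_comm, hB, add_zero]
  rw [Set.ncard_sdiff hsub, h4]
  have hrad : cubeForm (1 : F) = 0 := (cubeForm_eq_zero_iff hodd 1).2 (Or.inr rfl)
  constructor
  · intro h
    have : 2 * {z | cubeForm x z = 0 ∧ cubeForm y z = 0}.ncard = Nat.card F := by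
      rcases h with h | h | h
      · rw [← two_mul_ncard_perp hodd (x := y) hy0 (fun hy => hxy (h.symm.trans hy.symm))]
        rw [← h, hrad]
        simp
      · rw [← two_mul_ncard_perp hodd (x := x) hx0 (fun hx => hxy (hx.trans h))]
        rw [← h, hrad]
        simp
      · have hy : y = x + 1 := by grind
        rw [← two_mul_ncard_perp hodd (x := x) hx0 (fun hx => hy0 (by grind))]
        rw [hy, cubeForm_add, hrad]
        simp
    omega
  · intro h
    push Not at h
    have := four_mul_ncard_perp hodd hx0 h.1.symm hy0 h.2.1.symm hxy h.2.2.symm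
    omega

end Counting

section CountingTriples

variable {F : Type*} [Field F] [Algebra (ZMod 2) F] [Finite F]

local notation "Tr" => Algebra.trace (ZMod 2) _

theorem ncard_isotropicTriples_eq_sum [Fintype F] : (isotropicTriples F).ncard =
    ∑ x : F, ∑ y : F, {z | ![z, y, x] ∈ isotropicTriples F}.ncard := by
  have heta : ∀ s : Fin 3 → F, ![s 0, s 1, s 2] = s := by
    intro s
    ext i
    fin_cases i <;> rfl
  let e : isotropicTriples F ≃ Σ x : F, Σ y : F, {z // ![z, y, x] ∈ isotropicTriples F} :=
    { toFun := fun s => ⟨s.1 2, s.1 1, s.1 0, by rw [heta]; exact s.2⟩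
      invFun := fun t => ⟨_, t.2.2.2⟩
      left_inv := fun s => Subtype.ext (heta s.1)
      right_inv := fun t => rfl }
  change Nat.card (isotropicTriples F) = _
  rw [Nat.card_congr e, Nat.card_sigma]
  refine Finset.sum_congr rfl fun x _ => ?_
  rw [Nat.card_sigma]
  rfl

/-- The number of bases of totally isotropic subgroups of order eight in a field with `8 u`
elements. -/
theorem ncard_isotropicTriples (hodd : Odd (Module.finrank (ZMod 2) F)) {u : ℕ}
    (hu : Nat.card F = 8 * u) :
    (isotropicTriples F).ncard = (8 * u - 2) * (4 * u - 4) * (2 * u - 1) := by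
  classical
  have := Fintype.ofFinite F
  have h2 := two_eq_zero F
  have hcard : Fintype.card F = 8 * u := by rw [← hu, Nat.card_eq_fintype_card]
  have hrad : cubeForm (1 : F) = 0 := (cubeForm_eq_zero_iff hodd 1).2 (Or.inr rfl)
  have hz : ∀ x y : F, {z | ![z, y, x] ∈ isotropicTriples F}.ncard =
      if x ≠ 0 ∧ y ≠ 0 ∧ x ≠ y ∧ cubeForm x y = 0 then
        if 1 = x ∨ 1 = y ∨ 1 = x + y then 4 * u - 4 else 2 * u - 4 else 0 := by
    intro x y
    by_cases h : x ≠ 0 ∧ y ≠ 0 ∧ x ≠ y ∧ cubeForm x y = 0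
    · have hset : {z | ![z, y, x] ∈ isotropicTriples F} =
          {z | cubeForm x z = 0 ∧ cubeForm y z = 0} \ {0, x, y, x + y} :=
        Set.ext fun z => mem_isotropicTriples_iff.trans (and_iff_right h)
      have h3 := ncard_third hodd h.1 h.2.1 h.2.2.1 h.2.2.2
      rw [if_pos h, hset]
      split_ifs with h1
      · have := h3.1 h1
        omega
      · have := h3.2 h1
        omega
    · have hset : {z | ![z, y, x] ∈ isotropicTriples F} = ∅ :=
        Set.eq_empty_of_forall_notMem fun z hz => h (mem_isotropicTriples_iff.1 hz).1
      rw [if_neg h, hset, Set.ncard_empty]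
  have hne : (Finset.univ.filter fun x : F => x ≠ 0 ∧ x ≠ 1).card = 8 * u - 2 := by
    have : (Finset.univ.filter fun x : F => x ≠ 0 ∧ x ≠ 1) = ({0, 1} : Finset F)ᶜ := by
      ext x
      simp
    rw [this, Finset.card_compl, hcard, Finset.card_pair zero_ne_one]
  have hrow : ∀ x : F, ∑ y : F, {z | ![z, y, x] ∈ isotropicTriples F}.ncard =
      (if x = 1 then (8 * u - 2) * (4 * u - 4) else 0) +
        if x ≠ 0 ∧ x ≠ 1 then 2 * (4 * u - 4) + (4 * u - 4) * (2 * u - 4) else 0 := by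
    intro x
    simp only [hz]
    by_cases hx0 : x = 0
    · simp [hx0]
    by_cases hx1 : x = 1
    · subst hx1
      have hsum : (8 * u - 2) * (4 * u - 4) =
          ∑ y : F, if y ≠ 0 ∧ y ≠ 1 then 4 * u - 4 else 0 := by
        rw [← Finset.sum_filter, Finset.sum_const, hne, smul_eq_mul]
      rw [hsum]
      simp only [if_true, hrad, ne_eq, not_true_eq_false, and_false, if_false, add_zero]
      refine Finset.sum_congr rfl fun y _ => ?_
      simp [eq_comm]
    · -- the terms `y = 1` and `y = x + 1`, and those with `1 ∉ ⟨x, y⟩`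
      have hpair : ({1, x + 1} : Finset F).card = 2 := Finset.card_pair (by grind)
      have hx1' : cubeForm x 1 = 0 := by rw [cubeForm_comm, hrad, LinearMap.zero_apply]
      have hrest : (Finset.univ.filter fun y : F => (cubeForm x y = 0 ∧ cubeForm (1 : F) y = 0) ∧
          ¬(y = 0 ∨ y = x ∨ y = 1 ∨ y = x + 1)).card = 4 * u - 4 := by
        have h3 := (ncard_third hodd hx0 one_ne_zero hx1 hx1').1 (Or.inr (Or.inl rfl))
        have : ({z | cubeForm x z = 0 ∧ cubeForm 1 z = 0} \ {0, x, 1, x + 1} : Set F) =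
            (Finset.univ.filter fun y : F => (cubeForm x y = 0 ∧ cubeForm (1 : F) y = 0) ∧
              ¬(y = 0 ∨ y = x ∨ y = 1 ∨ y = x + 1) : Finset F) := by
          ext y
          simp
        rw [this, Set.ncard_coe_finset] at h3
        omega
      have hsplit : ∀ y : F, (if x ≠ 0 ∧ y ≠ 0 ∧ x ≠ y ∧ cubeForm x y = 0 then
          if 1 = x ∨ 1 = y ∨ 1 = x + y then 4 * u - 4 else 2 * u - 4 else 0) =
          (if y ∈ ({1, x + 1} : Finset F) then 4 * u - 4 else 0) +
            if (cubeForm x y = 0 ∧ cubeForm (1 : F) y = 0) ∧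
              ¬(y = 0 ∨ y = x ∨ y = 1 ∨ y = x + 1) then 2 * u - 4 else 0 := by
        intro y
        have e1 : (1 = x + y) ↔ y = x + 1 := by constructor <;> intro h <;> grind
        have e2 : cubeForm (1 : F) y = 0 := by rw [hrad, LinearMap.zero_apply]
        simp only [Finset.mem_insert, Finset.mem_singleton, e1]
        by_cases hy1 : y = 1
        · subst hy1
          simp [hx0, hx1, hx1']
        by_cases hyx : y = x + 1
        · have hB : cubeForm x y = 0 := by rw [hyx, map_add, cubeForm_self, hx1', add_zero]
          have hy0 : y ≠ 0 := by grind
          have hxy : x ≠ y := by grind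
          simp only [hyx]
          simp
          grind
        · simp only [hy1, hyx, e2, Ne.symm hx1, eq_comm (a := (1 : F)) (b := y), or_false,
            if_false, zero_add, and_true, not_or, eq_comm (a := y) (b := x), ne_eq, hx0,
            not_false_eq_true, true_and]
          congr 1
          apply propext
          tauto
      simp only [hsplit]
      rw [Finset.sum_add_distrib, Finset.sum_ite_mem, Finset.univ_inter, Finset.sum_const, hpair,
        ← Finset.sum_filter, Finset.sum_const, hrest]
      simp [hx0, hx1]
  rw [ncard_isotropicTriples_eq_sum]
  simp only [hrow]
  rw [Finset.sum_add_distrib, Finset.sum_ite_eq' Finset.univ (1 : F), ← Finset.sum_filter,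
    Finset.sum_const, hne, if_pos (Finset.mem_univ _), smul_eq_mul]
  rcases lt_or_ge u 2 with hu2 | hu2
  · have : 4 * u - 4 = 0 := by omega
    simp [this]
  · obtain ⟨w, rfl⟩ := Nat.exists_eq_add_of_le hu2
    rw [show 8 * (2 + w) - 2 = 8 * w + 14 by omega, show 4 * (2 + w) - 4 = 4 * w + 4 by omega,
      show 2 * (2 + w) - 4 = 2 * w by omega, show 2 * (2 + w) - 1 = 2 * w + 3 by omega]
    ring

/-- The totally isotropic subgroups of order eight. -/
def IsIsotropicOctet (A : Submodule (ZMod 2) F) : Prop :=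
  Nat.card A = 8 ∧ ∀ x ∈ A, ∀ y ∈ A, cubeForm x y = 0

/-- A totally isotropic subgroup of order eight has `7 · 6 · 4` bases. -/
theorem card_isotropicOctet_mul :
    Nat.card {A : Submodule (ZMod 2) F // IsIsotropicOctet A} * 168 =
      (isotropicTriples F).ncard := by
  classical
  have hspan : ∀ (A : Submodule (ZMod 2) F), Nat.card A = 8 → ∀ s : Fin 3 → A,
      LinearIndependent (ZMod 2) s →
      Submodule.span (ZMod 2) (Set.range fun i => (s i : F)) = A := by
    intro A hA s hs
    have hs' : LinearIndependent (ZMod 2) fun i => (s i : F) :=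
      hs.map' A.subtype (Submodule.ker_subtype A)
    refine Submodule.eq_of_le_of_finrank_eq (Submodule.span_le.2 ?_) ?_
    · rintro _ ⟨i, rfl⟩
      exact (s i).2
    · rw [finrank_span_eq_card hs', finrank_eq_three hA, Fintype.card_fin]
  let I := {A : Submodule (ZMod 2) F // IsIsotropicOctet A}
  have := Fintype.ofFinite I
  let g : (Σ A : I, {s : Fin 3 → A.1 // LinearIndependent (ZMod 2) s}) → isotropicTriples F :=
    fun t => ⟨fun i => (t.2.1 i : F), t.2.2.map' t.1.1.subtype (Submodule.ker_subtype _),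
      fun i j => t.1.2.2 _ (t.2.1 i).2 _ (t.2.1 j).2⟩
  have hg : Function.Bijective g := by
    constructor
    · rintro ⟨⟨A, hA⟩, s, hs⟩ ⟨⟨A', hA'⟩, s', hs'⟩ h
      have hfun : (fun i => (s i : F)) = fun i => (s' i : F) := congrArg Subtype.val h
      have hAA : A = A' := by
        rw [← hspan A hA.1 s hs, ← hspan A' hA'.1 s' hs', hfun]
      subst hAA
      have : s = s' := funext fun i => Subtype.ext (congrFun hfun i)
      subst this
      rfl
    · rintro ⟨s, hs, hB⟩
      set A := Submodule.span (ZMod 2) (Set.range s) with hAdef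
      have hmem : ∀ i, s i ∈ A := fun i => Submodule.subset_span ⟨i, rfl⟩
      have hcardA : Nat.card A = 8 := by
        rw [Module.natCard_eq_pow_finrank (K := ZMod 2), Nat.card_zmod, finrank_span_eq_card hs,
          Fintype.card_fin]
        norm_num
      have hle : ∀ x, (∀ i, cubeForm (s i) x = 0) → ∀ y ∈ A, cubeForm x y = 0 := by
        intro x hx
        have : A ≤ LinearMap.ker (cubeForm x) := Submodule.span_le.2 (by
          rintro _ ⟨i, rfl⟩
          exact (cubeForm_comm _ _).trans (hx i))
        exact fun y hy => this hy
      have hiso : IsIsotropicOctet A :=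
        ⟨hcardA, fun x hx => hle x fun i => hle (s i) (fun j => hB j i) x hx⟩
      refine ⟨⟨⟨A, hiso⟩, ⟨fun i => ⟨s i, hmem i⟩, ?_⟩⟩, rfl⟩
      exact LinearIndependent.of_comp A.subtype hs
  change Nat.card I * 168 = Nat.card (isotropicTriples F)
  rw [← Nat.card_congr (Equiv.ofBijective g hg), Nat.card_sigma]
  have hfib : ∀ A : I, Nat.card {s : Fin 3 → A.1 // LinearIndependent (ZMod 2) s} = 168 := by
    intro A
    have h3 := finrank_eq_three A.2.1
    rw [card_linearIndependent h3.ge, h3, ZMod.card]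
    rfl
  simp only [hfib]
  rw [Finset.sum_const, Finset.card_univ, smul_eq_mul, Nat.card_eq_fintype_card]

end CountingTriples

/-! ### Isomorphism classes and Frobenius orbits -/

section Classes

variable {F : Type*} [Field F] [Algebra (ZMod 2) F]

local notation "Tr" => Algebra.trace (ZMod 2) _

theorem IsNormalPair.isIsotropicOctet {A : Submodule (ZMod 2) F} {m : F} (h : IsNormalPair A m) :
    IsIsotropicOctet A :=
  ⟨h.card, fun _ hx _ hy => h.isotropic hx hy⟩

theorem IsIsotropicOctet.map {A : Submodule (ZMod 2) F} (h : IsIsotropicOctet A)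
    (σ : F ≃ₐ[ZMod 2] F) : IsIsotropicOctet (A.map σ.toLinearMap) := by
  refine ⟨?_, ?_⟩
  · rw [← h.1]
    exact (Nat.card_congr (A.equivMapOfInjective _ σ.injective).toEquiv).symm
  · rintro _ ⟨x, hx, rfl⟩ _ ⟨y, hy, rfl⟩
    have h0 := h.2 x hx y hy
    rw [cubeForm_apply] at h0 ⊢
    rw [← h0, ← Algebra.trace_eq_of_algEquiv σ (x ^ 2 * y + x * y ^ 2)]
    simp

variable [Finite F]

/-- On a totally isotropic subgroup the function `Tr (l³)` is additive, hence of the form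
`Tr (m l)`. -/
theorem IsIsotropicOctet.exists_isNormalPair {A : Submodule (ZMod 2) F} (h : IsIsotropicOctet A) :
    ∃ m, IsNormalPair A m := by
  have h2 := two_eq_zero F
  obtain ⟨m, hm⟩ := exists_trace_mul_eq A (fun l => Tr (l ^ 3)) fun x hx y hy => by
    have e : (x + y) ^ 3 = x ^ 3 + y ^ 3 + (x ^ 2 * y + x * y ^ 2) := by grind
    have h0 := h.2 x hx y hy
    rw [cubeForm_apply] at h0
    rw [e, map_add, map_add, h0, add_zero]
  refine ⟨m, h.1, fun l hl => ?_⟩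
  rw [map_add, hm l hl]
  exact CharTwo.add_self_eq_zero _

/-- If the degree of `F` is prime, every automorphism other than the identity fixes only `0`
and `1`. -/
theorem eq_zero_or_one_of_fixed (hp : (Module.finrank (ZMod 2) F).Prime) {σ : F ≃ₐ[ZMod 2] F}
    (hσ : σ ≠ 1) {x : F} (hx : σ x = x) : x = 0 ∨ x = 1 := by
  have := Fact.mk hp
  have hcard : Nat.card (F ≃ₐ[ZMod 2] F) = Module.finrank (ZMod 2) F :=
    IsGalois.card_aut_eq_finrank (ZMod 2) F
  have htop := zpowers_eq_top_of_prime_card hcard hσ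
  have hall : ∀ τ : F ≃ₐ[ZMod 2] F, τ x = x := by
    intro τ
    have hτ : τ ∈ Subgroup.zpowers σ := htop ▸ Subgroup.mem_top τ
    have hle : Subgroup.zpowers σ ≤ MulAction.stabilizer (F ≃ₐ[ZMod 2] F) x := by
      rw [Subgroup.zpowers_le]
      exact hx
    exact hle hτ
  obtain ⟨r, rfl⟩ := (IsGalois.mem_range_algebraMap_iff_fixed x).2 hall
  have hr : ∀ r : ZMod 2, r = 0 ∨ r = 1 := by decide
  rcases hr r with rfl | rfl
  · exact Or.inl (map_zero _)
  · exact Or.inr (map_one _)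

/-- If the degree of `F` is a prime greater than `3` and other than `7`, the automorphism group acts
freely on the subgroups of order eight: an automorphism of prime order `p` that maps such a group to
itself fixes a number of its elements congruent to `8` modulo `p`, but at least one and at most
two. -/
theorem eq_one_of_map_eq (hp : (Module.finrank (ZMod 2) F).Prime)
    (h3 : 3 < Module.finrank (ZMod 2) F) (h7 : Module.finrank (ZMod 2) F ≠ 7)
    {A : Submodule (ZMod 2) F} (hA : Nat.card A = 8) {σ : F ≃ₐ[ZMod 2] F}
    (hσ : A.map σ.toLinearMap = A) : σ = 1 := by
  classical
  by_contra hne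
  set p := Module.finrank (ZMod 2) F with hpdef
  have := Fact.mk hp
  have := Fintype.ofFinite A
  have hmem : ∀ x ∈ A, σ x ∈ A := fun x hx => hσ ▸ ⟨x, hx, rfl⟩
  let f : Function.End A := fun x => ⟨σ x, hmem x x.2⟩
  have hpow : ∀ k (x : A), ((f ^ k) x : F) = (σ ^ k) x := by
    intro k
    induction k with
    | zero => intro x; rfl
    | succ k ih =>
      intro x
      rw [pow_succ, pow_succ]
      exact ih (f x)
  have hσp : σ ^ p = 1 := by
    have hcard : Nat.card (F ≃ₐ[ZMod 2] F) = p := IsGalois.card_aut_eq_finrank (ZMod 2) F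
    rw [← hcard, pow_card_eq_one']
  have hf : f ^ p ^ 1 = 1 := by
    funext x
    apply Subtype.ext
    rw [pow_one, hpow, hσp]
    rfl
  have hmod := Equiv.Perm.card_fixedPoints_modEq (p := p) (n := 1) hf
  rw [← Nat.card_eq_fintype_card, hA] at hmod
  have hle : Fintype.card f.fixedPoints ≤ 2 := by
    have hinj : Function.Injective fun x : f.fixedPoints =>
        (⟨((x : A) : F), by
          have hx : σ ((x : A) : F) = (x : A) := congrArg Subtype.val x.2
          rw [Finset.mem_insert, Finset.mem_singleton]
          exact eq_zero_or_one_of_fixed hp hne hx⟩ : ({0, 1} : Finset F)) := by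
      intro x y hxy
      exact Subtype.ext (Subtype.ext (by simpa using hxy))
    have := Fintype.card_le_of_injective _ hinj
    rwa [Fintype.card_coe, Finset.card_pair zero_ne_one] at this
  have hpos : 0 < Fintype.card f.fixedPoints := by
    refine Fintype.card_pos_iff.2 ⟨⟨0, ?_⟩⟩
    exact Subtype.ext (map_zero σ)
  have hdvd : p ∣ 8 - Fintype.card f.fixedPoints :=
    (Nat.modEq_iff_dvd' (hle.trans (by norm_num))).1 hmod.symm
  have hp8 : p ≤ 7 := (Nat.le_of_dvd (by omega) hdvd).trans (by omega)
  have hcases : Fintype.card f.fixedPoints = 1 ∨ Fintype.card f.fixedPoints = 2 := by omega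
  have hp456 : p = 4 ∨ p = 5 ∨ p = 6 := by omega
  rcases hcases with h | h <;> rw [h] at hdvd <;> rcases hp456 with h' | h' | h' <;>
    rw [h'] at hdvd hp <;> revert hdvd hp <;> norm_num

/-- The isomorphism classes of proper Mathon arcs of degree eight correspond to the orbits of the
automorphism group on the totally isotropic subgroups of order eight. -/
theorem card_isotropicOctet_eq_mul (hp : (Module.finrank (ZMod 2) F).Prime)
    (h3 : 3 < Module.finrank (ZMod 2) F) (h7 : Module.finrank (ZMod 2) F ≠ 7) :
    Nat.card {A : Submodule (ZMod 2) F // IsIsotropicOctet A} =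
      numProperMathonArcs F 8 * Module.finrank (ZMod 2) F := by
  have hodd : Odd (Module.finrank (ZMod 2) F) := hp.odd_of_ne_two (by omega)
  have hq : 32 ≤ Nat.card F := by
    rw [card_eq_two_pow]
    have h5 : 5 ≤ Module.finrank (ZMod 2) F := by
      rcases hodd with ⟨k, hk⟩
      omega
    exact (show 32 = 2 ^ 5 by norm_num) ▸ Nat.pow_le_pow_right (by norm_num) h5
  choose m hm using fun A : {A : Submodule (ZMod 2) F // IsIsotropicOctet A} =>
    A.2.exists_isNormalPair
  let f : {A : Submodule (ZMod 2) F // IsIsotropicOctet A} → Quotient (properMathonSetoid F 8) :=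
    fun A => Quotient.mk _ ⟨arc (normalFamily A.1 (m A)), (hm A).isProperMathonArc hodd hq⟩
  have hf : ∀ A B, f A = f B ↔ ∃ σ : F ≃ₐ[ZMod 2] F, B.1.map σ.toLinearMap = A.1 := by
    intro A B
    rw [eq_comm, Quotient.eq]
    constructor
    · intro h
      exact exists_map_eq_of_isomorphic_normal hodd hq B.2.1 A.2.1 h
    · rintro ⟨σ, hσ⟩
      change Isomorphic (arc (normalFamily B.1 (m B))) (arc (normalFamily A.1 (m A)))
      rw [← hσ]
      exact isomorphic_normal_map σ _ _ _
  have hsurj : Function.Surjective f := by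
    intro c
    induction c using Quotient.inductionOn with
    | h K =>
      obtain ⟨A, m', hA, hiso⟩ := K.2.exists_isomorphic_normal hodd
      refine ⟨⟨A, hA.isIsotropicOctet⟩, Quotient.sound ?_⟩
      have h1 := isomorphic_normal_map (AlgEquiv.refl : F ≃ₐ[ZMod 2] F) A
        (m ⟨A, hA.isIsotropicOctet⟩) m'
      have hid : A.map (AlgEquiv.refl : F ≃ₐ[ZMod 2] F).toLinearMap = A := Submodule.map_id A
      rw [hid] at h1
      exact h1.trans hiso
  have hfib : ∀ c, Nat.card {A // f A = c} = Module.finrank (ZMod 2) F := by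
    intro c
    obtain ⟨B, rfl⟩ := hsurj c
    rw [← IsGalois.card_aut_eq_finrank (ZMod 2) F]
    let g : (F ≃ₐ[ZMod 2] F) → {A // f A = f B} := fun σ =>
      ⟨⟨B.1.map σ.toLinearMap, B.2.map σ⟩, (hf _ _).2 ⟨σ, rfl⟩⟩
    refine (Nat.card_eq_of_bijective g ⟨fun σ τ h => ?_, fun A => ?_⟩).symm
    · have h1 : B.1.map σ.toLinearMap = B.1.map τ.toLinearMap :=
        congrArg (fun A => A.1.1) h
      have h4 : B.1.map (τ⁻¹ * σ).toLinearMap = B.1 := by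
        have h5 := congrArg (Submodule.map (τ⁻¹ : F ≃ₐ[ZMod 2] F).toLinearMap) h1
        rw [← Submodule.map_comp, ← Submodule.map_comp] at h5
        have h6 : (τ⁻¹ : F ≃ₐ[ZMod 2] F).toLinearMap ∘ₗ τ.toLinearMap = LinearMap.id := by
          ext x
          exact τ.symm_apply_apply x
        rw [h6, Submodule.map_id] at h5
        exact h5
      exact (inv_mul_eq_one.1 (eq_one_of_map_eq hp h3 h7 B.2.1 h4)).symm
    · obtain ⟨σ, hσ⟩ := (hf _ _).1 A.2
      exact ⟨σ, Subtype.ext (Subtype.ext hσ)⟩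
  have := Finite.of_surjective f hsurj
  have := Fintype.ofFinite (Quotient (properMathonSetoid F 8))
  rw [← Nat.card_congr (Equiv.sigmaFiberEquiv f), Nat.card_sigma]
  simp only [hfib]
  rw [Finset.sum_const, Finset.card_univ, smul_eq_mul, numProperMathonArcs,
    Nat.card_eq_fintype_card]

/-- In the plane of order eight there are no totally isotropic subgroups of order eight, hence no
proper Mathon arcs of degree eight. -/
theorem numProperMathonArcs_eq_zero (h3 : Module.finrank (ZMod 2) F = 3) :
    numProperMathonArcs F 8 = 0 := by
  have hodd : Odd (Module.finrank (ZMod 2) F) := by rw [h3]; decide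
  have hcount := card_isotropicOctet_mul (F := F)
  rw [ncard_isotropicTriples hodd (u := 1) (by rw [card_eq_two_pow, h3]; norm_num)] at hcount
  have h0 : Nat.card {A : Submodule (ZMod 2) F // IsIsotropicOctet A} = 0 := by omega
  have hempty := (Nat.card_eq_zero.1 h0).resolve_right (not_infinite_iff_finite.2 inferInstance)
  have : IsEmpty (Quotient (properMathonSetoid F 8)) := ⟨fun c => by
    induction c using Quotient.inductionOn with
    | h K =>
      obtain ⟨A, m, hA, -⟩ := K.2.exists_isomorphic_normal hodd
      exact hempty.false ⟨A, hA.isIsotropicOctet⟩⟩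
  exact Nat.card_eq_zero.2 (Or.inl this)

end Classes
end PG2

theorem mainTheorem1 (h : ℕ) (hp : (2 * h + 1).Prime) (h7 : 2 * h + 1 ≠ 7)
    (F : Type*) [Field F] [Algebra (ZMod 2) F] (hF : Nat.card F = 2 ^ (2 * h + 1))
    (N : ℚ) (hN : N = (2 ^ (2 * h) - 1) / (3 * (2 * (h : ℚ) + 1))) :
    (PG2.numProperMathonArcs F 8 : ℚ) =
      N / 14 * (2 ^ (2 * h - 2) - 1) * ((6 * (h : ℚ) + 3) * N - 1) := by
  have : Finite F := Nat.finite_of_card_ne_zero (by rw [hF]; positivity)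
  have hrank : Module.finrank (ZMod 2) F = 2 * h + 1 :=
    Nat.pow_right_injective le_rfl (PG2.card_eq_two_pow.symm.trans hF)
  have hh : h ≠ 0 := by
    rintro rfl
    exact Nat.not_prime_one hp
  by_cases h1 : h = 1
  · subst h1
    rw [PG2.numProperMathonArcs_eq_zero (by rw [hrank])]
    norm_num
  have hodd : Odd (Module.finrank (ZMod 2) F) := by
    rw [hrank]
    exact ⟨h, rfl⟩
  obtain ⟨u, hu⟩ : ∃ u, u = 2 ^ (2 * h - 2) := ⟨_, rfl⟩
  have hq : Nat.card F = 8 * u := by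
    rw [hF, hu, show (8 : ℕ) = 2 ^ 3 by norm_num, ← pow_add]
    congr 1
    omega
  have hpow : (2 : ℚ) ^ (2 * h) = 4 * u := by
    rw [hu, Nat.cast_pow, Nat.cast_ofNat, show (4 : ℚ) = 2 ^ 2 by norm_num, ← pow_add]
    congr 1
    omega
  have hu1 : 1 ≤ u := hu ▸ Nat.one_le_two_pow
  have hcount := PG2.card_isotropicOctet_mul (F := F)
  rw [PG2.ncard_isotropicTriples hodd hq, PG2.card_isotropicOctet_eq_mul (hrank ▸ hp) (by omega)
    (hrank ▸ h7), hrank] at hcount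
  have hcountQ := congrArg (Nat.cast : ℕ → ℚ) hcount
  push_cast [Nat.cast_sub (show 2 ≤ 8 * u by omega), Nat.cast_sub (show 4 ≤ 4 * u by omega),
    Nat.cast_sub (show 1 ≤ 2 * u by omega)] at hcountQ
  have hu' : (2 : ℚ) ^ (2 * h - 2) = u := by rw [hu]; push_cast; rfl
  have hpos : (2 * (h : ℚ) + 1) ≠ 0 := by positivity
  rw [hN, hpow, hu']
  field_simp
  linear_combination 3 / 4 * (2 * (h : ℚ) + 1) * hcountQ
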